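/- **Setting.** Let $P$ be a probability distribution on a measurable space $\mathcal X$, let $\psi$ be a real-valued functional of probability distributions on $\mathcal X$, with target $\psi=\psi(P)$, and let $X_1,\dots,X_n$ be i.i.d. from $P$ with empirical distribution $\hat P_n=\frac1n\sum_{i=1}^n\delta_{X_i}$. For $b=1,\dots,B$ let $P_n^{*b}$ be the empirical distribution of the $b$-th resample, obtained by drawing independently and uniformly with replacement $n$ times from $\{X_1,\dots,X_n\}$; the resamples are independent given the data, and $P_n^*$ denotes one of them. Put $\hat\psi_n=\psi(\hat P_n)$, $\psi_n^{*}=\psi(P_n^{*})$. The value $\psi(Q)$ cannot be computed exactly: for an input distribution $Q$ one can only generate independent computation runs $\hat\psi_r(Q)$, $r=1,2,\dots$, with $E[\hat\psi_r(Q)]=\psi(Q)$ (required for $Q=P$ and for every empirical distribution $Q$ of finitely many points). Write $\tau^2(Q)=\mathrm{Var}(\hat\psi_r(Q))$ and $\kappa_3(Q)=E|\hat\psi_r(Q)-\psi(Q)|^3$. With fresh independent runs given the data and the resamples, define $$\hat{\hat\psi}_{n,R_0}=\frac1{R_0}\sum_{r=1}^{R_0}\hat\psi_r(\hat P_n),\qquad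 \psi^{**b}_{n,R}=\frac1R\sum_{r=1}^{R}\hat\psi_r(P_n^{*b}),\quad b=1,\dots,B.$$ **Assumptions.** 1. For some $\sigma^2>0$, $\sqrt n(\hat\psi_n-\psi)\Rightarrow N(0,\sigma^2)$, and for every $x\in\mathbb R$, $\mathbb P(\sqrt n(\psi_n^*-\hat\psi_n)\le x\mid X_1,\dots,X_n)\to \mathbb P(N(0,\sigma^2)\le x)$ in probability, as $n\to\infty$. 2. $0<\tau^2(P)<\infty$, $\kappa_3(P)<\infty$, and, as $n\to\infty$, $\tau^2(\hat P_n)\to\tau^2(P)$, $\kappa_3(\hat P_n)\to\kappa_3(P)$, $\tau^2(P_n^*)\to\tau^2(P)$ and $\kappa_3(P_n^*)\to\kappa_3(P)$ in probability. 3. The computation sizes $R_0=R_0(n)$ and $R=R(n)$ satisfy $R_0/n\to p_0$ and $R/n\to p$ as $n\to\infty$, for constants $0<p_0,p<1$. Put $\rho=\sqrt{p_0/p}$. **Theorem.** Let $B\ge 2$ be a fixed integer and $0<\alpha<1$. Let $$S_M^2=\frac1{B-1}\sum_{b=1}^B\Big(\psi_{n,R}^{**b}-\frac1B\sum_{c=1}^B\psi_{n,R}^{**c}\Big)^2,\qquad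 q_{M,1-\alpha/2}=\max\{\rho^{-1},1\}\,t_{B-1,1-\alpha/2},$$ where $t_{B-1,1-\alpha/2}$ is the $(1-\alpha/2)$-quantile of Student's $t$-distribution with $B-1$ degrees of freedom, and let $$\mathcal I_M=\big[\hat{\hat\psi}_{n,R_0}-q_{M,1-\alpha/2}S_M,\ \hat{\hat\psi}_{n,R_0}+q_{M,1-\alpha/2}S_M\big].$$ Under the assumptions above, $$\liminf_{n\to\infty}\mathbb P_n(\psi\in\mathcal I_M)\ge 1-\alpha,$$ where $\mathbb P_n$ is the probability with respect to the data, the resampling and the computation runs. Moreover, if $\rho=1$, then $$\lim_{n\to\infty}\mathbb P_n(\psi\in\mathcal I_M)=1-\alpha.$$ -/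

import Mathlib

open MeasureTheory ProbabilityTheory Filter Topology
open scoped NNReal ENNReal

noncomputable section

namespace CheapBootstrap

/-! ### Generic probabilistic notions -/

/-- Convergence in probability to a constant `c` of random elements `f i`, where `f i` lives on
its own probability space `(Ω i, μ i)`. -/
def TendstoInProbability {ι E : Type*} [EDist E] {Ω : ι → Type*}
    [∀ i, MeasurableSpace (Ω i)] (μ : ∀ i, Measure (Ω i)) (f : ∀ i, Ω i → E)
    (l : Filter ι) (c : E) : Prop :=
  ∀ ε : ℝ≥0∞, 0 < ε → Tendsto (fun i => μ i {ω | ε ≤ edist (f i ω) c}) l (𝓝 0)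

/-- Student's `t`-distribution with `k` degrees of freedom: the law of `Z / √(Y / k)` with
`Z ∼ N(0,1)` and `Y = V₁² + ⋯ + V_k² ∼ χ²_k` independent. -/
def studentT (k : ℕ) : Measure ℝ :=
  ((gaussianReal 0 1).prod (Measure.pi fun _ : Fin k => gaussianReal 0 1)).map
    (fun zv => zv.1 / √((∑ i, zv.2 i ^ 2) / k))

/-- The `p`-quantile of a distribution on the real line. -/
def quantile (μ : Measure ℝ) (p : ℝ) : ℝ := sInf {q : ℝ | p ≤ μ.real (Set.Iic q)}

/-! ### Data, resamples and computation runs -/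

variable {𝒳 Ξ : Type*} [MeasurableSpace 𝒳] [MeasurableSpace Ξ]

/-- The empirical distribution `(1/n) ∑ δ_{x i}` of a data set of size `n ≥ 1`. -/
def empirical (n : ℕ+) (x : Fin n → 𝒳) : ProbabilityMeasure 𝒳 :=
  ⟨((n : ℕ) : ℝ≥0∞)⁻¹ • ∑ i, Measure.dirac (x i), ⟨by
    have h : ((n : ℕ) : ℝ≥0∞) ≠ 0 := by exact_mod_cast n.ne_zero
    simp [ENNReal.inv_mul_cancel h]⟩⟩

/-- The law of an i.i.d. data set `X₁, …, Xₙ` from `P`. -/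
def dataLaw (P : ProbabilityMeasure 𝒳) (n : ℕ+) : Measure (Fin n → 𝒳) :=
  Measure.pi fun _ => (P : Measure 𝒳)

instance (P : ProbabilityMeasure 𝒳) (n : ℕ+) : IsProbabilityMeasure (dataLaw P n) := by
  unfold dataLaw; infer_instance

/-- The law of the indices of one resample: `n` independent uniform draws (with replacement) from
the `n` data positions. -/
def indexLaw (n : ℕ+) : Measure (Fin n → Fin n) :=
  Measure.pi fun _ => (PMF.uniformOfFintype (Fin n)).toMeasure

instance (n : ℕ+) : IsProbabilityMeasure (indexLaw n) := by
  unfold indexLaw; infer_instance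

/-- The empirical distribution of the resample `x (I 1), …, x (I n)` of the data set `x`. -/
def resampleEmpirical (n : ℕ+) (x : Fin n → 𝒳) (I : Fin n → Fin n) : ProbabilityMeasure 𝒳 :=
  empirical n fun i => x (I i)

/-- `h Q ξ` is the output of one computation run driven by the input distribution `Q`, where `ξ`
is the computation randomness of the run, of law `ν`. This says that the runs at `Q` are unbiased
outputs for `ψ Q`. -/
def UnbiasedAt (ψ : ProbabilityMeasure 𝒳 → ℝ) (h : ProbabilityMeasure 𝒳 → Ξ → ℝ) (ν : Measure Ξ)
    (Q : ProbabilityMeasure 𝒳) : Prop :=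
  Integrable (h Q) ν ∧ ∫ ξ, h Q ξ ∂ν = ψ Q

/-- The variance `τ²(Q)` of a computation run driven by `Q`, possibly infinite. -/
def runVariance (h : ProbabilityMeasure 𝒳 → Ξ → ℝ) (ν : Measure Ξ)
    (Q : ProbabilityMeasure 𝒳) : ℝ≥0∞ :=
  evariance (h Q) ν

/-- The third absolute central moment `κ₃(Q)` of a computation run driven by `Q`, possibly
infinite. -/
def runThirdMoment (ψ : ProbabilityMeasure 𝒳 → ℝ) (h : ProbabilityMeasure 𝒳 → Ξ → ℝ)
    (ν : Measure Ξ) (Q : ProbabilityMeasure 𝒳) : ℝ≥0∞ :=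
  ∫⁻ ξ, ‖h Q ξ - ψ Q‖ₑ ^ 3 ∂ν

/-- A computation procedure: runs driven by empirical distributions are (jointly) measurable in the
data and the computation randomness, and the runs driven by `P` and by every empirical distribution
are unbiased. -/
structure IsComputation (P : ProbabilityMeasure 𝒳) (ψ : ProbabilityMeasure 𝒳 → ℝ)
    (h : ProbabilityMeasure 𝒳 → Ξ → ℝ) (ν : Measure Ξ) : Prop where
  measurable_run : ∀ n : ℕ+,
    Measurable fun xξ : (Fin n → 𝒳) × Ξ => h (empirical n xξ.1) xξ.2
  unbiased : UnbiasedAt ψ h ν P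
  unbiased_empirical : ∀ (n : ℕ+) (x : Fin n → 𝒳), UnbiasedAt ψ h ν (empirical n x)

/-- Standard condition for bootstrap validity: `√n (ψ̂ₙ - ψ) ⇒ N(0, σ²)` and, for one resample
estimate, `√n (ψₙ* - ψ̂ₙ) ⇒ N(0, σ²)` conditionally on the data, in probability. -/
structure BootstrapValid (P : ProbabilityMeasure 𝒳) (ψ : ProbabilityMeasure 𝒳 → ℝ)
    (σ : ℝ≥0) : Prop where
  original : TendstoInDistribution
    (fun (n : ℕ+) (x : Fin n → 𝒳) => √(n : ℝ) * (ψ (empirical n x) - ψ P)) atTop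
    (id : ℝ → ℝ) (fun n => dataLaw P n) (gaussianReal 0 (σ ^ 2))
  resample : ∀ t : ℝ, TendstoInProbability (fun n : ℕ+ => dataLaw P n)
    (fun n x => (indexLaw n).real
      {I | √(n : ℝ) * (ψ (resampleEmpirical n x I) - ψ (empirical n x)) ≤ t})
    atTop ((gaussianReal 0 (σ ^ 2)).real (Set.Iic t))

/-- Moment consistency of computation runs: `0 < τ²(P) < ∞`, `κ₃(P) < ∞`, and `τ²`, `κ₃` at the
empirical distribution and at a resample empirical distribution converge in probability to their
values at `P`. -/
structure MomentConsistent (P : ProbabilityMeasure 𝒳) (ψ : ProbabilityMeasure 𝒳 → ℝ)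
    (h : ProbabilityMeasure 𝒳 → Ξ → ℝ) (ν : Measure Ξ) : Prop where
  variance_pos : 0 < runVariance h ν P
  variance_lt_top : runVariance h ν P < ∞
  thirdMoment_lt_top : runThirdMoment ψ h ν P < ∞
  variance_original : TendstoInProbability (fun n : ℕ+ => dataLaw P n)
    (fun n x => runVariance h ν (empirical n x)) atTop (runVariance h ν P)
  thirdMoment_original : TendstoInProbability (fun n : ℕ+ => dataLaw P n)
    (fun n x => runThirdMoment ψ h ν (empirical n x)) atTop (runThirdMoment ψ h ν P)
  variance_resample : TendstoInProbability (fun n : ℕ+ => (dataLaw P n).prod (indexLaw n))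
    (fun n xI => runVariance h ν (resampleEmpirical n xI.1 xI.2)) atTop (runVariance h ν P)
  thirdMoment_resample : TendstoInProbability (fun n : ℕ+ => (dataLaw P n).prod (indexLaw n))
    (fun n xI => runThirdMoment ψ h ν (resampleEmpirical n xI.1 xI.2)) atTop
    (runThirdMoment ψ h ν P)

/-! ### The nested experiment and the interval centered at the resample mean -/

/-- Outcomes of the nested experiment: the data, the indices of the `B` resamples, the randomness
of the `R₀` runs for the original estimate, and the randomness of the `R` runs for each of the `B`
resample estimates. -/
abbrev Outcome (𝒳 Ξ : Type*) (B : ℕ) (n : ℕ+) (R₀ R : ℕ) : Type _ :=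
  (Fin n → 𝒳) × (Fin B → Fin n → Fin n) × (Fin R₀ → Ξ) × (Fin B → Fin R → Ξ)

/-- The probability `ℙₙ` of the nested experiment: data, resampling indices and computation
randomness are all independent. -/
def nestedLaw (P : ProbabilityMeasure 𝒳) (ν : Measure Ξ) (B : ℕ) (n : ℕ+) (R₀ R : ℕ) :
    Measure (Outcome 𝒳 Ξ B n R₀ R) :=
  (dataLaw P n).prod ((Measure.pi fun _ : Fin B => indexLaw n).prod
    ((Measure.pi fun _ : Fin R₀ => ν).prod
      (Measure.pi fun _ : Fin B => Measure.pi fun _ : Fin R => ν)))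

variable {B : ℕ} {n : ℕ+} {R₀ R : ℕ}

/-- The original point estimate: the average of `R₀` runs driven by the empirical distribution. -/
def pointEstimate (h : ProbabilityMeasure 𝒳 → Ξ → ℝ) (ω : Outcome 𝒳 Ξ B n R₀ R) : ℝ :=
  (1 / (R₀ : ℝ)) * ∑ r, h (empirical n ω.1) (ω.2.2.1 r)

/-- The `b`-th resample estimate: the average of `R` runs driven by the `b`-th resample empirical
distribution. -/
def resampleEstimate (h : ProbabilityMeasure 𝒳 → Ξ → ℝ) (ω : Outcome 𝒳 Ξ B n R₀ R)
    (b : Fin B) : ℝ :=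
  (1 / (R : ℝ)) * ∑ r, h (resampleEmpirical n ω.1 (ω.2.1 b)) (ω.2.2.2 b r)

/-- The sample mean of the resample estimates. -/
def resampleMean (h : ProbabilityMeasure 𝒳 → Ξ → ℝ) (ω : Outcome 𝒳 Ξ B n R₀ R) : ℝ :=
  (1 / (B : ℝ)) * ∑ b, resampleEstimate h ω b

/-- The sample variance `S_M²` of the resample estimates. -/
def sampleVariance (h : ProbabilityMeasure 𝒳 → Ξ → ℝ) (ω : Outcome 𝒳 Ξ B n R₀ R) : ℝ :=
  (1 / ((B : ℝ) - 1)) * ∑ b, (resampleEstimate h ω b - resampleMean h ω) ^ 2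

/-- The critical value `max{ρ⁻¹, 1} · t_{B-1, 1-α/2}`. -/
def criticalValue (B : ℕ) (ρ α : ℝ) : ℝ :=
  max ρ⁻¹ 1 * quantile (studentT (B - 1)) (1 - α / 2)

/-- The interval centered at the original point estimate, with half-width the critical value times
the sample standard deviation `S_M` of the resample estimates. -/
def meanCenteredInterval (h : ProbabilityMeasure 𝒳 → Ξ → ℝ) (ρ α : ℝ)
    (ω : Outcome 𝒳 Ξ B n R₀ R) : Set ℝ :=
  Set.Icc (pointEstimate h ω - criticalValue B ρ α * √(sampleVariance h ω))
    (pointEstimate h ω + criticalValue B ρ α * √(sampleVariance h ω))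

/-- The coverage probability of the interval for the target `ψ P`. -/
def coverage (P : ProbabilityMeasure 𝒳) (ψ : ProbabilityMeasure 𝒳 → ℝ)
    (h : ProbabilityMeasure 𝒳 → Ξ → ℝ) (ν : Measure Ξ) (B : ℕ) (ρ α : ℝ)
    (n : ℕ+) (R₀ R : ℕ) : ℝ :=
  (nestedLaw P ν B n R₀ R).real {ω | ψ P ∈ meanCenteredInterval h ρ α ω}

end CheapBootstrap

end

noncomputable section

namespace CheapBootstrap

section

/-! ### Characteristic functions of normalized sums -/

/-! Multiply every error by √n: the point estimate is centered at the target, the resample estimates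
at the value of ψ at the empirical distribution. Each error is then a statistical error plus an
independent average of centered runs. The vector of these errors converges in law to independent
centered Gaussians, with variance σ² + τ²(P)/p₀ for the point estimate and σ² + τ²(P)/p for each
resample estimate (`tendsto_normalizedErrorsLaw`).

The proof uses characteristic functions. Given the data, the joint one factors
(`charFun_map_normalizedErrors`). The run factors are N-th powers, close to a Gaussian value with an
error controlled by τ² and κ₃ uniformly in the input distribution
(`exists_norm_runCharFun_pow_sub_lt`). Each resample contributes a conditional factor that converges
in mean to a constant (`tendsto_integral_resampleCharFun`). Only the factor of √n(ψ̂ₙ - ψ) stays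
random in the limit, so the errors become independent although they share the data
(`tendsto_charFun_normalizedErrors`).

The sample variance ignores shifts and is quadratic under scaling, so coverage is an event about
this vector (`mem_meanCenteredInterval_iff`). The boundary of the event is null for the limit law,
hence coverage converges. The limit is the probability that |T| ≤ q √(σ² + τ²/p) / √(σ² + τ²/p₀),
where q is the critical value and T has Student's law with B - 1 degrees of freedom
(`gaussianLimit_real_coverageRegion`). The factor max{ρ⁻¹, 1} in q makes this threshold at least the
Student quantile, with equality when ρ = 1. -/

lemma norm_exp_mul_I_sub_taylor_le (x : ℝ) :
    ‖Complex.exp (x * Complex.I) - (1 + x * Complex.I - (x : ℂ) ^ 2 / 2)‖ ≤ 4 * |x| ^ 3 := by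
  rcases le_total |x| 1 with hx | hx
  · have h := Complex.exp_bound (x := x * Complex.I) (by simpa using hx) (n := 3) (by norm_num)
    have e : ∑ m ∈ Finset.range 3, ((x : ℂ) * Complex.I) ^ m / (m.factorial : ℂ) =
        1 + x * Complex.I - (x : ℂ) ^ 2 / 2 := by
      simp [Finset.sum_range_succ, mul_pow, Nat.factorial]
      ring
    rw [e] at h
    refine h.trans ?_
    have h3 : 0 ≤ |x| ^ 3 := by positivity
    norm_num [Nat.factorial]
    nlinarith
  · have h1 : ‖Complex.exp (x * Complex.I)‖ = 1 := Complex.norm_exp_ofReal_mul_I x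
    have h2 : ‖1 + x * Complex.I - (x : ℂ) ^ 2 / 2‖ ≤ 1 + |x| + |x| ^ 2 / 2 := by
      refine (norm_sub_le _ _).trans ?_
      gcongr
      · exact (norm_add_le _ _).trans (by simp)
      · simp
    refine (norm_sub_le _ _).trans ?_
    rw [h1]
    -- Here 2 + |x| + |x|²/2 ≤ 7/2 · |x|³; this crude range is what dictates the constant 4.
    have h3 : |x| ≤ |x| ^ 3 := le_self_pow₀ hx (by norm_num)
    have h4 : |x| ^ 2 ≤ |x| ^ 3 := pow_le_pow_right₀ hx (by norm_num)
    linarith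

/-- Second-order expansion of the characteristic function of a centered variable. -/
lemma norm_integral_exp_sub_le {Ω : Type*} [MeasurableSpace Ω] {μ : Measure Ω}
    [IsProbabilityMeasure μ] {Y : Ω → ℝ} (hY : AEMeasurable Y μ) (h3 : MemLp Y 3 μ)
    (h0 : ∫ ω, Y ω ∂μ = 0) (u : ℝ) :
    ‖∫ ω, Complex.exp ((u * Y ω : ℝ) * Complex.I) ∂μ -
        (1 - ((u ^ 2 * (∫ ω, Y ω ^ 2 ∂μ) / 2 : ℝ) : ℂ))‖ ≤
      4 * |u| ^ 3 * ∫ ω, |Y ω| ^ 3 ∂μ := by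
  have i1 : Integrable Y μ := h3.integrable (by norm_num)
  have h2 : MemLp Y 2 μ := h3.mono_exponent (by norm_num)
  have i2 : Integrable (fun ω => Y ω ^ 2) μ := h2.integrable_sq
  have i3 : Integrable (fun ω => |Y ω| ^ 3) μ := by
    simpa using h3.integrable_norm_pow (by norm_num)
  have ie : Integrable (fun ω => Complex.exp ((u * Y ω : ℝ) * Complex.I)) μ := by
    refine (integrable_const (1 : ℝ)).mono ?_ ?_
    · exact (Complex.measurable_exp.comp_aemeasurable (by fun_prop)).aestronglyMeasurable
    · exact ae_of_all _ fun ω => by rw [Complex.norm_exp_ofReal_mul_I]; simp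
  have j1 : Integrable (fun ω => (1 : ℂ) + ((u * Y ω : ℝ) : ℂ) * Complex.I) μ :=
    (integrable_const _).add ((i1.const_mul u).ofReal.mul_const _)
  have j2 : Integrable (fun ω => ((u * Y ω : ℝ) : ℂ) ^ 2 / 2) μ := by
    simp_rw [← Complex.ofReal_pow, mul_pow]
    exact (i2.const_mul _).ofReal.div_const _
  have it : Integrable (fun ω => 1 + ((u * Y ω : ℝ) : ℂ) * Complex.I
      - ((u * Y ω : ℝ) : ℂ) ^ 2 / 2) μ := j1.sub j2
  have e : ∫ ω, (1 + ((u * Y ω : ℝ) : ℂ) * Complex.I - ((u * Y ω : ℝ) : ℂ) ^ 2 / 2) ∂μ =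
      1 - ((u ^ 2 * (∫ ω, Y ω ^ 2 ∂μ) / 2 : ℝ) : ℂ) := by
    rw [integral_sub j1 j2, integral_add (integrable_const _) ((i1.const_mul u).ofReal.mul_const _),
      integral_mul_const, integral_div, integral_complex_ofReal, integral_const_mul, h0]
    simp_rw [← Complex.ofReal_pow, mul_pow]
    rw [integral_complex_ofReal, integral_const_mul]
    simp
  rw [← e, ← integral_sub ie it]
  refine (norm_integral_le_integral_norm _).trans ?_
  rw [← integral_const_mul]
  refine integral_mono (ie.sub it).norm (i3.const_mul _) fun ω => ?_
  refine (norm_exp_mul_I_sub_taylor_le (u * Y ω)).trans (le_of_eq ?_)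
  rw [abs_mul]; ring

lemma norm_pow_sub_pow_le {z w : ℂ} (hz : ‖z‖ ≤ 1) (hw : ‖w‖ ≤ 1) (N : ℕ) :
    ‖z ^ N - w ^ N‖ ≤ N * ‖z - w‖ := by
  induction N with
  | zero => simp
  | succ k ih =>
    have e : z ^ (k + 1) - w ^ (k + 1) = z ^ k * (z - w) + (z ^ k - w ^ k) * w := by ring
    rw [e]
    refine (norm_add_le _ _).trans ?_
    rw [norm_mul, norm_mul, norm_pow]
    have h1 : ‖z‖ ^ k * ‖z - w‖ ≤ 1 * ‖z - w‖ := by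
      gcongr; exact pow_le_one₀ (norm_nonneg _) hz
    have h2 : ‖z ^ k - w ^ k‖ * ‖w‖ ≤ (k * ‖z - w‖) * 1 := by gcongr
    push_cast
    linarith

lemma abs_exp_neg_sub_le {y : ℝ} (hy : 0 ≤ y) : |Real.exp (-y) - (1 - y)| ≤ y ^ 2 := by
  rcases le_total y 1 with h | h
  · have := Real.abs_exp_sub_one_sub_id_le (x := -y) (by rw [abs_neg, abs_of_nonneg hy]; exact h)
    rw [neg_sq] at this
    convert this using 2; ring
  · rw [abs_of_nonneg (by linarith [Real.add_one_le_exp (-y)])]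
    have : Real.exp (-y) ≤ 1 := Real.exp_le_one_iff.2 (by linarith)
    nlinarith

/-- Non-asymptotic central limit bound for characteristic functions. -/
lemma norm_integral_exp_pow_sub_le {Ω : Type*} [MeasurableSpace Ω] {μ : Measure Ω}
    [IsProbabilityMeasure μ] {Y : Ω → ℝ} (hY : AEMeasurable Y μ) (h3 : MemLp Y 3 μ)
    (h0 : ∫ ω, Y ω ∂μ = 0) (u : ℝ) (N : ℕ) :
    ‖(∫ ω, Complex.exp ((u * Y ω : ℝ) * Complex.I) ∂μ) ^ N -
        (Real.exp (-(N * u ^ 2 * (∫ ω, Y ω ^ 2 ∂μ) / 2)) : ℝ)‖ ≤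
      N * (4 * |u| ^ 3 * ∫ ω, |Y ω| ^ 3 ∂μ + (u ^ 2 * (∫ ω, Y ω ^ 2 ∂μ) / 2) ^ 2) := by
  set v := ∫ ω, Y ω ^ 2 ∂μ with hv
  have hv0 : 0 ≤ v := integral_nonneg fun _ => sq_nonneg _
  have hy : 0 ≤ u ^ 2 * v / 2 := by positivity
  -- Both terms become N-th powers of numbers in the unit disc, so the error is at most N times the
  -- error for a single run.
  have e : ((Real.exp (-(N * u ^ 2 * v / 2)) : ℝ) : ℂ) =
      ((Real.exp (-(u ^ 2 * v / 2)) : ℝ) : ℂ) ^ N := by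
    rw [← Complex.ofReal_pow, ← Real.exp_nat_mul]
    congr 3; ring
  rw [e]
  refine (norm_pow_sub_pow_le ?_ ?_ N).trans ?_
  · refine (norm_integral_le_integral_norm _).trans ?_
    simp_rw [Complex.norm_exp_ofReal_mul_I]
    simp
  · rw [Complex.norm_real, Real.norm_eq_abs, Real.abs_exp]
    exact Real.exp_le_one_iff.2 (by linarith)
  · gcongr
    have h1 := norm_integral_exp_sub_le hY h3 h0 u
    have h2 := abs_exp_neg_sub_le hy
    rw [abs_sub_comm, ← Real.norm_eq_abs, ← Complex.norm_real] at h2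
    push_cast at h1 h2 ⊢
    refine (le_trans (le_of_eq ?_) (norm_add_le _ _)).trans (add_le_add h1 h2)
    congr 1; ring

/-! ### Convergence in probability and in mean -/

/-- Bounded convergence when the probability space varies with the index: splitting at level δ
bounds the integral by δ + |C| μ(g ≥ δ). -/
lemma tendsto_integral_zero_of_tendsto_measure {ι : Type*} {l : Filter ι} {Ω : ι → Type*}
    [∀ i, MeasurableSpace (Ω i)] {μ : ∀ i, Measure (Ω i)} [∀ i, IsProbabilityMeasure (μ i)]
    {g : ∀ i, Ω i → ℝ} {C : ℝ} (hg : ∀ i, Measurable (g i)) (h0 : ∀ i ω, 0 ≤ g i ω)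
    (hC : ∀ i ω, g i ω ≤ C)
    (h : ∀ δ > 0, Tendsto (fun i => μ i {ω | δ ≤ g i ω}) l (𝓝 0)) :
    Tendsto (fun i => ∫ ω, g i ω ∂μ i) l (𝓝 0) := by
  have key : ∀ δ > 0, ∀ i, ∫ ω, g i ω ∂μ i ≤ δ + |C| * (μ i).real {ω | δ ≤ g i ω} := by
    intro δ hδ i
    have hm : MeasurableSet {ω | δ ≤ g i ω} := measurableSet_le measurable_const (hg i)
    have hle : ∀ ω, g i ω ≤ δ + Set.indicator {ω | δ ≤ g i ω} (fun _ => |C|) ω := by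
      intro ω
      by_cases hω : δ ≤ g i ω
      · rw [Set.indicator_of_mem (by exact hω)]
        linarith [hC i ω, le_abs_self C]
      · rw [Set.indicator_of_notMem (by exact hω)]
        linarith
    have hi : Integrable (fun ω => δ + Set.indicator {ω | δ ≤ g i ω} (fun _ => |C|) ω) (μ i) :=
      (integrable_const _).add ((integrable_const _).indicator hm)
    refine (integral_mono_of_nonneg (ae_of_all _ (h0 i)) hi (ae_of_all _ hle)).trans ?_
    rw [integral_add (integrable_const _) ((integrable_const _).indicator hm),
      integral_indicator_const _ hm]
    simp [mul_comm]
  rw [tendsto_order]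
  refine ⟨fun a ha => Eventually.of_forall fun i => ha.trans_le (integral_nonneg (h0 i)),
    fun a ha => ?_⟩
  have ht : Tendsto (fun i => a / 2 + |C| * (μ i).real {ω | a / 2 ≤ g i ω}) l
      (𝓝 (a / 2 + |C| * 0)) :=
    (((ENNReal.tendsto_toReal ENNReal.zero_ne_top).comp (h (a / 2) (by linarith))).const_mul
      _).const_add _
  filter_upwards [ht.eventually_lt_const (u := a) (by linarith)] with i hi
  exact (key _ (by linarith) i).trans_lt hi

/-- Sets covered by finitely many sets whose measures tend to zero have measures tending to zero. -/
lemma tendsto_measure_of_subset_union {ι : Type*} {l : Filter ι} {Ω : ι → Type*}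
    [∀ i, MeasurableSpace (Ω i)] {μ : ∀ i, Measure (Ω i)} {κ : Type*} (T : Finset κ)
    {A : ∀ i, Set (Ω i)} {D : κ → ∀ i, Set (Ω i)}
    (hD : ∀ k ∈ T, Tendsto (fun i => μ i (D k i)) l (𝓝 0))
    (hA : ∀ᶠ i in l, A i ⊆ ⋃ k ∈ T, D k i) : Tendsto (fun i => μ i (A i)) l (𝓝 0) := by
  have hs : Tendsto (fun i => ∑ k ∈ T, μ i (D k i)) l (𝓝 0) := by
    simpa using tendsto_finsetSum T hD
  refine tendsto_of_tendsto_of_tendsto_of_le_of_le' tendsto_const_nhds hs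
    (Eventually.of_forall fun _ => zero_le) ?_
  filter_upwards [hA] with i hi
  exact (measure_mono hi).trans (measure_biUnion_finset_le _ _)

/-! ### Distribution functions and characteristic functions -/

/-- Half-open intervals with rational endpoints form a π-system containing arbitrarily small
neighbourhoods of each point, so convergence of their masses determines weak convergence. -/
lemma tendsto_of_forall_rat_tendsto_cdf {μ : ℕ → ProbabilityMeasure ℝ} {ν : ProbabilityMeasure ℝ}
    (h : ∀ q : ℚ, Tendsto (fun k => (μ k : Measure ℝ).real (Set.Iic (q : ℝ))) atTop
      (𝓝 ((ν : Measure ℝ).real (Set.Iic (q : ℝ))))) : Tendsto μ atTop (𝓝 ν) := by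
  have hS : IsPiSystem {s : Set ℝ | ∃ a b : ℚ, s = Set.Ioc (a : ℝ) (b : ℝ)} := by
    rintro _ ⟨a, b, rfl⟩ _ ⟨c, d, rfl⟩ -
    exact ⟨max a c, min b d, by rw [Set.Ioc_inter_Ioc]; push_cast; rfl⟩
  refine hS.tendsto_probabilityMeasure_of_tendsto_of_mem ?_ ?_ ?_
  · rintro _ ⟨a, b, rfl⟩; exact measurableSet_Ioc
  · intro u hu x hx
    obtain ⟨ε, hε, hball⟩ := Metric.isOpen_iff.1 hu x hx
    obtain ⟨a, ha, ha'⟩ := exists_rat_btwn (show x - ε < x by linarith)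
    obtain ⟨b, hb, hb'⟩ := exists_rat_btwn (show x < x + ε by linarith)
    refine ⟨_, ⟨a, b, rfl⟩, Ioc_mem_nhds ha' hb, fun y hy => hball ?_⟩
    rw [Metric.mem_ball, Real.dist_eq, abs_lt]
    constructor <;> linarith [hy.1, hy.2]
  · rintro _ ⟨a, b, rfl⟩
    rw [← NNReal.tendsto_coe]
    -- Using `max a b` instead of `b` keeps the difference formula valid for empty intervals.
    have e : ∀ m : ProbabilityMeasure ℝ, ((m (Set.Ioc (a : ℝ) b) : ℝ≥0) : ℝ) =
        (m : Measure ℝ).real (Set.Iic ((max a b : ℚ) : ℝ)) - (m : Measure ℝ).real (Set.Iic (a : ℝ)) := by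
      intro m
      have hsub : Set.Iic (a : ℝ) ⊆ Set.Iic ((max a b : ℚ) : ℝ) :=
        Set.Iic_subset_Iic.2 (by exact_mod_cast le_max_left a b)
      rw [← measureReal_sdiff hsub measurableSet_Iic]
      change (m : Measure ℝ).real _ = _
      congr 1
      ext y
      simp only [Set.mem_Ioc, Set.mem_sdiff, Set.mem_Iic, not_le, Rat.cast_max, le_max_iff]
      constructor
      · rintro ⟨h1, h2⟩; exact ⟨Or.inr h2, h1⟩
      · rintro ⟨h1 | h1, h2⟩
        · linarith
        · exact ⟨h2, h1⟩
    simp_rw [e]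
    exact (h _).sub (h _)

/-- The value of a characteristic function at a point is controlled by finitely many values of the
distribution function. -/
lemma exists_finset_cdf_charFun_lt (ν : Measure ℝ) [IsProbabilityMeasure ν] (s : ℝ) {δ : ℝ}
    (hδ : 0 < δ) : ∃ T : Finset ℝ, ∃ ε > 0, ∀ μ : Measure ℝ, IsProbabilityMeasure μ →
      (∀ t ∈ T, |μ.real (Set.Iic t) - ν.real (Set.Iic t)| < ε) → ‖charFun μ s - charFun ν s‖ < δ := by
  -- If no pair (T, ε) works, testing the first k rationals with tolerance 1/(k+1) yields measures
  -- that converge weakly to ν while their characteristic functions at s stay δ away.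
  by_contra hcon
  push Not at hcon
  obtain ⟨q, hq⟩ := exists_surjective_nat ℚ
  choose μ hμ hclose hfar using fun k : ℕ =>
    hcon ((Finset.range k).image fun j => (q j : ℝ)) (1 / ((k : ℝ) + 1)) (by positivity)
  have hconv : Tendsto (β := ProbabilityMeasure ℝ) (fun k => ⟨μ k, hμ k⟩) atTop
      (𝓝 ⟨ν, inferInstance⟩) := by
    refine tendsto_of_forall_rat_tendsto_cdf fun r => ?_
    obtain ⟨j, rfl⟩ := hq r
    rw [tendsto_iff_norm_sub_tendsto_zero]
    refine squeeze_zero' (Eventually.of_forall fun _ => norm_nonneg _) ?_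
      tendsto_one_div_add_atTop_nhds_zero_nat
    filter_upwards [eventually_gt_atTop j] with k hk
    exact (hclose k _ (Finset.mem_image_of_mem _ (Finset.mem_range.2 hk))).le
  have hc := (ProbabilityMeasure.tendsto_iff_tendsto_charFun.1 hconv) s
  rw [tendsto_iff_norm_sub_tendsto_zero] at hc
  obtain ⟨k, hk⟩ := (hc.eventually_lt_const hδ).exists
  exact absurd hk (not_lt.2 (hfar k))

end

/-! ### Computation runs: Gaussian approximation uniform in the input distribution. -/

section

/-- The moments of a run may be infinite at some inputs; being at finite extended distance from a
finite value rules this out. -/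
lemma abs_toReal_sub_lt_of_edist_lt {a b : ℝ≥0∞} (hb : b ≠ ∞) {ε : ℝ}
    (h : edist a b < ENNReal.ofReal ε) : a ≠ ∞ ∧ |a.toReal - b.toReal| < ε := by
  have ha : a ≠ ∞ := by
    rintro rfl
    rw [(ENNReal.edist_eq_top_iff ∞ b).2 ⟨hb.symm, Or.inl rfl⟩] at h
    exact not_top_lt h
  refine ⟨ha, ?_⟩
  lift a to ℝ≥0 using ha
  lift b to ℝ≥0 using hb
  change edist a b < _ at h
  rw [edist_dist] at h
  have := (ENNReal.ofReal_lt_ofReal_iff_of_nonneg dist_nonneg).1 h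
  rwa [NNReal.dist_eq] at this

/-! ### Characteristic functions of computation runs -/

variable {𝒳 Ξ : Type*} [MeasurableSpace 𝒳] [MeasurableSpace Ξ]

/-- The characteristic function at `u` of the centered output of one run driven by `Q`. -/
def runCharFun (ψ : ProbabilityMeasure 𝒳 → ℝ) (h : ProbabilityMeasure 𝒳 → Ξ → ℝ) (ν : Measure Ξ)
    (Q : ProbabilityMeasure 𝒳) (u : ℝ) : ℂ :=
  ∫ ξ, Complex.exp ((u * (h Q ξ - ψ Q) : ℝ) * Complex.I) ∂ν

variable {ψ : ProbabilityMeasure 𝒳 → ℝ} {h : ProbabilityMeasure 𝒳 → Ξ → ℝ} {ν : Measure Ξ}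

lemma IsComputation.measurable_apply {P : ProbabilityMeasure 𝒳} (hc :
    IsComputation P ψ h ν) (n : ℕ+) (x : Fin n → 𝒳) :
    Measurable (h (empirical n x)) := by
  have hx : Measurable fun ξ : Ξ => (x, ξ) := measurable_prodMk_left
  exact ((hc.measurable_run n).comp hx :)

variable [IsProbabilityMeasure ν]

lemma norm_runCharFun_le (Q : ProbabilityMeasure 𝒳) (u : ℝ) : ‖runCharFun ψ h ν Q u‖ ≤ 1 := by
  refine (norm_integral_le_integral_norm _).trans ?_
  simp_rw [Complex.norm_exp_ofReal_mul_I]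
  simp

lemma norm_runCharFun_pow_le (Q : ProbabilityMeasure 𝒳) (u : ℝ) (N : ℕ) :
    ‖runCharFun ψ h ν Q u ^ N‖ ≤ 1 := by
  rw [norm_pow]
  exact pow_le_one₀ (norm_nonneg _) (norm_runCharFun_le _ _)

lemma norm_runCharFun_pow_sub_le {Q : ProbabilityMeasure 𝒳} (hm : Measurable (h Q))
    (hQ : UnbiasedAt ψ h ν Q) (h3 : runThirdMoment ψ h ν Q ≠ ∞) (u : ℝ) (N : ℕ) :
    ‖runCharFun ψ h ν Q u ^ N -
        (Real.exp (-(N * u ^ 2 * (runVariance h ν Q).toReal / 2)) : ℝ)‖ ≤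
      N * (4 * |u| ^ 3 * (runThirdMoment ψ h ν Q).toReal
        + (u ^ 2 * (runVariance h ν Q).toReal / 2) ^ 2) := by
  have hY : Measurable fun ξ => h Q ξ - ψ Q := hm.sub_const _
  have hv : ∫ ξ, (h Q ξ - ψ Q) ^ 2 ∂ν = (runVariance h ν Q).toReal := by
    have := variance_eq_integral (X := h Q) (μ := ν) hm.aemeasurable
    rw [hQ.2] at this
    exact this.symm
  have hk : ∫ ξ, |h Q ξ - ψ Q| ^ 3 ∂ν = (runThirdMoment ψ h ν Q).toReal := by
    rw [runThirdMoment, integral_eq_lintegral_of_nonneg_ae (ae_of_all _ fun _ => by positivity)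
      (by fun_prop)]
    congr 1
    refine lintegral_congr fun ξ => ?_
    rw [← Real.norm_eq_abs, ENNReal.ofReal_pow (norm_nonneg _), ofReal_norm]
  have hL : MemLp (fun ξ => h Q ξ - ψ Q) 3 ν := by
    refine ⟨hY.aestronglyMeasurable, ?_⟩
    rw [eLpNorm_lt_top_iff_lintegral_rpow_enorm_lt_top (by norm_num) (by norm_num)]
    refine lt_of_eq_of_lt (lintegral_congr fun ξ => ?_) (lt_top_iff_ne_top.2 h3)
    rw [ENNReal.toReal_ofNat, ENNReal.rpow_ofNat]
  have h0 : ∫ ξ, (h Q ξ - ψ Q) ∂ν = 0 := by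
    rw [integral_sub hQ.1 (integrable_const _), hQ.2]; simp
  have := norm_integral_exp_pow_sub_le hY.aemeasurable hL h0 u N
  rw [hv, hk] at this
  exact this

lemma abs_exp_neg_sub_exp_neg_le {a b : ℝ} (ha : 0 ≤ a) (hb : 0 ≤ b) :
    |Real.exp (-a) - Real.exp (-b)| ≤ |a - b| := by
  wlog hab : a ≤ b generalizing a b
  · rw [abs_sub_comm, abs_sub_comm a]; exact this hb ha (le_of_not_ge hab)
  have h1 : Real.exp (-b) ≤ Real.exp (-a) := Real.exp_le_exp.2 (by linarith)
  rw [abs_of_nonneg (by linarith), abs_of_nonpos (by linarith)]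
  have e : Real.exp (-b) = Real.exp (-a) * Real.exp (-(b - a)) := by
    rw [← Real.exp_add]; congr 1; ring
  have h2 := Real.add_one_le_exp (-(b - a))
  have h3 : Real.exp (-a) ≤ 1 := Real.exp_le_one_iff.2 (by linarith)
  have h4 : 0 < Real.exp (-a) := Real.exp_pos _
  rw [e]
  nlinarith

lemma tendsto_pnat_natCast_atTop : Tendsto (fun n : ℕ+ => ((n : ℕ) : ℝ)) atTop atTop := by
  refine tendsto_natCast_atTop_atTop.comp ?_
  exact tendsto_atTop_atTop.2 fun b => ⟨b.succPNat, fun a ha =>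
    (Nat.le_succ b).trans (PNat.coe_le_coe _ _ |>.2 ha)⟩

/-- If the variance and the third moment at `Q` are close to those at `P`, the normalized sums of
runs driven by `Q` are nearly Gaussian, uniformly in `Q`. -/
lemma exists_norm_runCharFun_pow_sub_lt {N : ℕ+ → ℕ} {p : ℝ} (hp : 0 < p)
    (hN : Tendsto (fun n : ℕ+ => (N n : ℝ) / (n : ℝ)) atTop (𝓝 p)) {v : ℝ} (hv : 0 ≤ v)
    {K : ℝ} (s : ℝ) {δ : ℝ} (hδ : 0 < δ) :
    ∃ ε > 0, ∀ᶠ n : ℕ+ in atTop, ∀ Q : ProbabilityMeasure 𝒳, Measurable (h Q) → UnbiasedAt ψ h ν Q →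
      runThirdMoment ψ h ν Q ≠ ∞ → (runThirdMoment ψ h ν Q).toReal ≤ K →
      |(runVariance h ν Q).toReal - v| < ε →
      ‖runCharFun ψ h ν Q (s * √(n : ℝ) / N n) ^ N n - (Real.exp (-(s ^ 2 * v / p / 2)) : ℝ)‖ < δ := by
  set c : ℝ := s ^ 2 / p with hc
  have hc0 : 0 ≤ c := by positivity
  -- The bound 1 gives τ ≤ v + 1; the bound δ/(c+1) makes the variance mismatch cost at most δ/2,
  -- and c + 1 avoids dividing by zero when s = 0.
  refine ⟨min 1 (δ / (c + 1)), by positivity, ?_⟩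
  have hn := tendsto_pnat_natCast_atTop
  have hinv : Tendsto (fun n : ℕ+ => (n : ℝ) / (N n : ℝ)) atTop (𝓝 p⁻¹) := by
    simpa using hN.inv₀ hp.ne'
  have hsq : Tendsto (fun n : ℕ+ => (√(n : ℝ))⁻¹) atTop (𝓝 0) :=
    tendsto_inv_atTop_zero.comp (Real.tendsto_sqrt_atTop.comp hn)
  have h1 : Tendsto (fun n : ℕ+ => |s| ^ 3 * ((n : ℝ) / N n) ^ 2 * (√(n : ℝ))⁻¹) atTop (𝓝 0) := by
    simpa using ((hinv.pow 2).const_mul (|s| ^ 3)).mul hsq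
  have h2 : Tendsto (fun n : ℕ+ => s ^ 4 * ((n : ℝ) / N n) ^ 3 * ((n : ℝ))⁻¹) atTop (𝓝 0) := by
    simpa using ((hinv.pow 3).const_mul (s ^ 4)).mul (tendsto_inv_atTop_zero.comp hn)
  have h3 : Tendsto (fun n : ℕ+ => s ^ 2 * ((n : ℝ) / N n)) atTop (𝓝 c) := by
    simpa [hc, div_eq_mul_inv] using hinv.const_mul (s ^ 2)
  -- With u = s√n/N, the three terms are the third-moment error N|u|³, of order n^(-1/2), the
  -- fourth-order error N u⁴, of order 1/n, and the error from replacing n/N by 1/p.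
  have h4 : Tendsto (fun n : ℕ+ => 4 * K * (|s| ^ 3 * ((n : ℝ) / N n) ^ 2 * (√(n : ℝ))⁻¹)
      + (v + 1) ^ 2 / 4 * (s ^ 4 * ((n : ℝ) / N n) ^ 3 * ((n : ℝ))⁻¹)
      + (v + 1) / 2 * |s ^ 2 * ((n : ℝ) / N n) - c|) atTop (𝓝 0) := by
    have h5 : Tendsto (fun n : ℕ+ => |s ^ 2 * ((n : ℝ) / N n) - c|) atTop (𝓝 0) := by
      simpa using (h3.sub_const c).abs
    simpa using ((h1.const_mul (4 * K)).add (h2.const_mul ((v + 1) ^ 2 / 4))).add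
      (h5.const_mul ((v + 1) / 2))
  have hNpos : ∀ᶠ n in atTop, 0 < (N n : ℝ) / (n : ℝ) := hN.eventually_const_lt hp
  filter_upwards [h4.eventually_lt_const (half_pos hδ), hNpos] with n hlt hNn Q hm hQ hk hkK hτ
  have hn0 : (0 : ℝ) < n := by exact_mod_cast n.pos
  have hN0 : (0 : ℝ) < N n := by
    rcases div_pos_iff.1 hNn with h | h
    · exact h.1
    · linarith [h.2]
  set τ := (runVariance h ν Q).toReal with hτdef
  set κ := (runThirdMoment ψ h ν Q).toReal with hκdef
  have hτ0 : 0 ≤ τ := ENNReal.toReal_nonneg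
  have hκ0 : 0 ≤ κ := ENNReal.toReal_nonneg
  have hτ1 : |τ - v| < 1 := hτ.trans_le (min_le_left _ _)
  have hτ2 : |τ - v| < δ / (c + 1) := hτ.trans_le (min_le_right _ _)
  have hτv : τ ≤ v + 1 := by linarith [(abs_lt.1 hτ1).2]
  have hsn : √(n : ℝ) ^ 2 = n := Real.sq_sqrt hn0.le
  have hsn0 : 0 < √(n : ℝ) := Real.sqrt_pos.2 hn0
  have hs4 : √(n : ℝ) ^ 4 = (n : ℝ) ^ 2 := by
    calc √(n : ℝ) ^ 4 = (√(n : ℝ) ^ 2) ^ 2 := by ring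
      _ = (n : ℝ) ^ 2 := by rw [hsn]
  set u : ℝ := s * √(n : ℝ) / N n with hu
  have e2 : N n * u ^ 2 = s ^ 2 * ((n : ℝ) / N n) := by
    rw [hu, div_pow, mul_pow, hsn]; field_simp
  have e3 : N n * |u| ^ 3 = |s| ^ 3 * ((n : ℝ) / N n) ^ 2 * (√(n : ℝ))⁻¹ := by
    rw [hu, abs_div, abs_mul, abs_of_pos hsn0, abs_of_pos hN0]
    field_simp
    rw [hs4]
  have e4 : N n * u ^ 4 = s ^ 4 * ((n : ℝ) / N n) ^ 3 * ((n : ℝ))⁻¹ := by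
    rw [hu, div_pow, mul_pow, hs4]; field_simp
  have b1 := norm_runCharFun_pow_sub_le hm hQ hk u (N n)
  rw [← hτdef, ← hκdef] at b1
  have b2 : (N n : ℝ) * (4 * |u| ^ 3 * κ + (u ^ 2 * τ / 2) ^ 2) ≤
      4 * K * (N n * |u| ^ 3) + (v + 1) ^ 2 / 4 * (N n * u ^ 4) := by
    have : (N n : ℝ) * (4 * |u| ^ 3 * κ + (u ^ 2 * τ / 2) ^ 2) =
      4 * κ * (N n * |u| ^ 3) + τ ^ 2 / 4 * (N n * u ^ 4) := by ring
    rw [this]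
    gcongr
  have b3 : ‖((Real.exp (-(N n * u ^ 2 * τ / 2)) : ℝ) : ℂ) - (Real.exp (-(s ^ 2 * v / p / 2)) : ℝ)‖ ≤
      (v + 1) / 2 * |s ^ 2 * ((n : ℝ) / N n) - c| + δ / 2 := by
    rw [← Complex.ofReal_sub, Complex.norm_real, Real.norm_eq_abs]
    refine (abs_exp_neg_sub_exp_neg_le (by positivity) (by positivity)).trans ?_
    have e : N n * u ^ 2 * τ / 2 - s ^ 2 * v / p / 2 =
        τ / 2 * (s ^ 2 * ((n : ℝ) / N n) - c) + c / 2 * (τ - v) := by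
      rw [e2, hc]; ring
    rw [e]
    refine (abs_add_le _ _).trans ?_
    rw [abs_mul, abs_mul, abs_of_nonneg (by positivity : 0 ≤ τ / 2),
      abs_of_nonneg (by positivity : 0 ≤ c / 2)]
    have hb : c / 2 * |τ - v| ≤ δ / 2 := by
      have h6 := hτ2.le
      rw [le_div_iff₀ (by linarith)] at h6
      nlinarith [abs_nonneg (τ - v)]
    gcongr
  rw [e3, e4] at b2
  have := norm_sub_le_norm_sub_add_norm_sub (runCharFun ψ h ν Q u ^ N n)
    ((Real.exp (-(N n * u ^ 2 * τ / 2)) : ℝ) : ℂ) ((Real.exp (-(s ^ 2 * v / p / 2)) : ℝ) : ℂ)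
  linarith

/-! ### Measurability -/

variable {P : ProbabilityMeasure 𝒳}

namespace IsComputation

/-- No measurability of ψ is assumed: unbiasedness writes it as the integral of a jointly measurable
run. -/
lemma measurable_functional (hc : IsComputation P ψ h ν) (n : ℕ+) :
    Measurable fun x : Fin n → 𝒳 => ψ (empirical n x) := by
  have e : (fun x : Fin n → 𝒳 => ψ (empirical n x)) = fun x => ∫ ξ, h (empirical n x) ξ ∂ν :=
    funext fun x => (hc.unbiased_empirical n x).2.symm
  rw [e]
  exact ((hc.measurable_run n).stronglyMeasurable.integral_prod_right').measurable

lemma measurable_runCharFun (hc : IsComputation P ψ h ν) (n : ℕ+) (u : ℝ) :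
    Measurable fun x : Fin n → 𝒳 => runCharFun ψ h ν (empirical n x) u := by
  have hm : Measurable fun xξ : (Fin n → 𝒳) × Ξ =>
      Complex.exp ((u * (h (empirical n xξ.1) xξ.2 - ψ (empirical n xξ.1)) : ℝ) * Complex.I) := by
    have h1 := hc.measurable_run n
    have h2 := (hc.measurable_functional n).comp 
      (measurable_fst : Measurable (Prod.fst : (Fin n → 𝒳) × Ξ → Fin n → 𝒳))
    exact Complex.measurable_exp.comp
      ((Complex.measurable_ofReal.comp ((h1.sub h2).const_mul u)).mul_const _)
  exact hm.stronglyMeasurable.integral_prod_right'.measurable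

end IsComputation

lemma measurable_resample (n : ℕ+) :
    Measurable fun xI : (Fin n → 𝒳) × (Fin n → Fin n) => fun i => xI.1 (xI.2 i) := by
  refine measurable_from_prod_countable_left fun I => ?_
  exact measurable_pi_lambda _ fun i => measurable_pi_apply _

/-- The abstract sample `X` lets one statement serve both the original data and a resample, the
latter under the joint law of data and indices. -/
lemma tendsto_integral_runCharFun_pow (hc : IsComputation P ψ h ν) {Ω : ℕ+ → Type*}
    [∀ n, MeasurableSpace (Ω n)] {μ : ∀ n, Measure (Ω n)} [∀ n, IsProbabilityMeasure (μ n)]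
    {X : ∀ n : ℕ+, Ω n → Fin n → 𝒳} (hX : ∀ n, Measurable (X n))
    (hv : runVariance h ν P ≠ ∞) (hk : runThirdMoment ψ h ν P ≠ ∞)
    (hv' : TendstoInProbability μ (fun n ω => runVariance h ν (empirical n (X n ω))) atTop
      (runVariance h ν P))
    (hk' : TendstoInProbability μ (fun n ω => runThirdMoment ψ h ν (empirical n (X n ω))) atTop
      (runThirdMoment ψ h ν P))
    {N : ℕ+ → ℕ} {p : ℝ} (hp : 0 < p)
    (hN : Tendsto (fun n : ℕ+ => (N n : ℝ) / (n : ℝ)) atTop (𝓝 p)) (s : ℝ) :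
    Tendsto (fun n => ∫ ω, ‖runCharFun ψ h ν (empirical n (X n ω)) (s * √(n : ℝ) / N n) ^ N n -
      (Real.exp (-(s ^ 2 * (runVariance h ν P).toReal / p / 2)) : ℝ)‖ ∂μ n) atTop (𝓝 0) := by
  set v := (runVariance h ν P).toReal
  set K := (runThirdMoment ψ h ν P).toReal
  refine tendsto_integral_zero_of_tendsto_measure (C := 2) (fun n => ?_)
    (fun n ω => norm_nonneg _) (fun n ω => ?_) fun δ hδ => ?_
  · exact ((((hc.measurable_runCharFun n _).comp (hX n)).pow_const _).sub_const _).norm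
  · refine (norm_sub_le _ _).trans ?_
    have h1 := norm_runCharFun_pow_le (ψ := ψ) (h := h) (ν := ν) (empirical n (X n ω))
      (s * √(n : ℝ) / N n) (N n)
    have h2 : ‖((Real.exp (-(s ^ 2 * v / p / 2)) : ℝ) : ℂ)‖ ≤ 1 := by
      rw [Complex.norm_real, Real.norm_eq_abs, Real.abs_exp]
      exact Real.exp_le_one_iff.2 (neg_nonpos.2 (by positivity))
    linarith
  -- The third moment only has to be bounded, so tolerance 1 and the bound K + 1 suffice; the
  -- variance must be within ε. The two bad events are indexed by `Bool`.
  · obtain ⟨ε, hε, hev⟩ := exists_norm_runCharFun_pow_sub_lt (ψ := ψ) (h := h) (ν := ν) hp hN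
      (v := v) ENNReal.toReal_nonneg (K := K + 1) s hδ
    refine tendsto_measure_of_subset_union (T := (Finset.univ : Finset Bool))
      (D := fun b n => if b then {ω | ENNReal.ofReal ε ≤
          edist (runVariance h ν (empirical n (X n ω))) (runVariance h ν P)} else
        {ω | ENNReal.ofReal 1 ≤
          edist (runThirdMoment ψ h ν (empirical n (X n ω))) (runThirdMoment ψ h ν P)}) ?_ ?_
    · rintro (_ | _) -
      · simpa using hk' (ENNReal.ofReal 1) (by simp)
      · simpa using hv' (ENNReal.ofReal ε) (by simpa using hε)
    · filter_upwards [hev] with n hn ω hω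
      by_contra hcon
      simp only [Finset.mem_univ, Set.mem_iUnion, Bool.exists_bool, if_true,
        Set.mem_ofPred_eq, not_or, not_le, Bool.false_eq_true, if_false,
        Set.iUnion_const] at hcon
      have h1 := abs_toReal_sub_lt_of_edist_lt hv hcon.2
      have h2 := abs_toReal_sub_lt_of_edist_lt hk hcon.1
      refine absurd hω (not_le.2 (hn _ (hc.measurable_apply n _) (hc.unbiased_empirical n _) h2.1
        ?_ h1.2))
      linarith [(abs_lt.1 h2.2).2]

end

/-! ### Conditional characteristic function of a resample estimate. -/

section

/-- The unit complex number `exp (i x)`. -/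
def expI (x : ℝ) : ℂ := Complex.exp (x * Complex.I)

lemma norm_expI (x : ℝ) : ‖expI x‖ = 1 := Complex.norm_exp_ofReal_mul_I x

lemma expI_add (x y : ℝ) : expI (x + y) = expI x * expI y := by
  simp [expI, add_mul, Complex.exp_add]

lemma expI_sum {ι : Type*} (T : Finset ι) (f : ι → ℝ) : expI (∑ i ∈ T, f i) = ∏ i ∈ T, expI (f i) := by
  simp [expI, Finset.sum_mul, Complex.exp_sum]

lemma measurable_expI : Measurable expI := by
  unfold expI; fun_prop

lemma integrable_expI {Ω : Type*} [MeasurableSpace Ω] {μ : Measure Ω} [IsFiniteMeasure μ]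
    {f : Ω → ℝ} (hf : Measurable f) : Integrable (fun ω => expI (f ω)) μ :=
  (integrable_const (1 : ℝ)).mono (measurable_expI.comp hf).aestronglyMeasurable
    (ae_of_all _ fun ω => by simp [norm_expI])

lemma norm_integral_le_one {Ω : Type*} [MeasurableSpace Ω] {μ : Measure Ω} [IsProbabilityMeasure μ]
    {f : Ω → ℂ} (hf : ∀ ω, ‖f ω‖ ≤ 1) : ‖∫ ω, f ω ∂μ‖ ≤ 1 := by
  simpa using norm_integral_le_of_norm_le_const (μ := μ) (ae_of_all _ hf)

lemma norm_finset_prod_sub_prod_le {ι : Type*} (T : Finset ι) {a b : ι → ℂ} (ha : ∀ i, ‖a i‖ ≤ 1)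
    (hb : ∀ i, ‖b i‖ ≤ 1) : ‖∏ i ∈ T, a i - ∏ i ∈ T, b i‖ ≤ ∑ i ∈ T, ‖a i - b i‖ := by
  classical
  induction T using Finset.induction_on with
  | empty => simp
  | insert j T hj ih =>
    rw [Finset.prod_insert hj, Finset.prod_insert hj, Finset.sum_insert hj]
    have e : a j * ∏ i ∈ T, a i - b j * ∏ i ∈ T, b i =
        (a j - b j) * ∏ i ∈ T, a i + b j * (∏ i ∈ T, a i - ∏ i ∈ T, b i) := by ring
    rw [e]
    refine (norm_add_le _ _).trans ?_
    rw [norm_mul, norm_mul]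
    have h1 : ‖∏ i ∈ T, a i‖ ≤ 1 := by
      rw [norm_prod]; exact Finset.prod_le_one (fun _ _ => norm_nonneg _) fun i _ => ha i
    refine add_le_add (mul_le_of_le_one_right (norm_nonneg _) h1) ?_
    exact (mul_le_of_le_one_left (norm_nonneg _) (hb j)).trans ih

variable {𝒳 Ξ : Type*} [MeasurableSpace 𝒳] [MeasurableSpace Ξ]
  {ψ : ProbabilityMeasure 𝒳 → ℝ} {h : ProbabilityMeasure 𝒳 → Ξ → ℝ} {ν : Measure Ξ}
  [IsProbabilityMeasure ν] {P : ProbabilityMeasure 𝒳}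

/-! ### One resample, conditionally on the data -/

/-- The normalized deviation `√n (ψₙ* - ψ̂ₙ)` of a resample. -/
def resampleDeviation (ψ : ProbabilityMeasure 𝒳 → ℝ) (n : ℕ+) (x : Fin n → 𝒳)
    (I : Fin n → Fin n) : ℝ :=
  √(n : ℝ) * (ψ (resampleEmpirical n x I) - ψ (empirical n x))

lemma IsComputation.measurable_resampleDeviation (hc : IsComputation P ψ h ν) (n : ℕ+) :
    Measurable fun xI : (Fin n → 𝒳) × (Fin n → Fin n) => resampleDeviation ψ n xI.1 xI.2 :=
  (((hc.measurable_functional n).comp (measurable_resample n)).sub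
    ((hc.measurable_functional n).comp measurable_fst)).const_mul _

/-- Conditionally on the data, the characteristic function of the normalized deviation of a
resample converges in mean. -/
lemma tendsto_integral_charFun_resampleDeviation (hc : IsComputation P ψ h ν) {σ : ℝ≥0}
    (hb : BootstrapValid P ψ σ) (s : ℝ) :
    Tendsto (fun n : ℕ+ => ∫ x, ‖∫ I, expI (s * resampleDeviation ψ n x I) ∂indexLaw n -
      charFun (gaussianReal 0 (σ ^ 2)) s‖ ∂dataLaw P n) atTop (𝓝 0) := by
  refine tendsto_integral_zero_of_tendsto_measure (C := 2) (fun n => ?_)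
    (fun n ω => norm_nonneg _) (fun n ω => ?_) fun δ hδ => ?_
  · have hm : Measurable fun xI : (Fin n → 𝒳) × (Fin n → Fin n) =>
        expI (s * resampleDeviation ψ n xI.1 xI.2) :=
      measurable_expI.comp ((hc.measurable_resampleDeviation n).const_mul s)
    exact (hm.stronglyMeasurable.integral_prod_right'.measurable.sub_const _).norm
  · refine (norm_sub_le _ _).trans ?_
    have h1 := norm_integral_le_one (μ := indexLaw n)
      (f := fun I => expI (s * resampleDeviation ψ n ω I)) fun I => (norm_expI _).le
    have h2 := norm_charFun_le_one (μ := gaussianReal 0 (σ ^ 2)) s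
    linarith
  -- An error of δ forces the conditional distribution function to be off by ε at some point of T:
  -- finitely many events, each of vanishing probability.
  · obtain ⟨T, ε, hε, hT⟩ := exists_finset_cdf_charFun_lt (gaussianReal 0 (σ ^ 2)) s hδ
    refine tendsto_measure_of_subset_union (T := T)
      (fun t _ => hb.resample t (ENNReal.ofReal ε) (by simpa using hε))
      (Eventually.of_forall fun n x hx => ?_)
    by_contra hcon
    simp only [Set.mem_iUnion, Set.mem_ofPred_eq, not_exists, not_le] at hcon
    have hU : Measurable (resampleDeviation ψ n x) := measurable_of_countable _
    rw [Set.mem_ofPred_eq] at hx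
    refine absurd hx (not_le.2 ?_)
    have key := hT ((indexLaw n).map (resampleDeviation ψ n x))
      (Measure.isProbabilityMeasure_map hU.aemeasurable) fun t ht => ?_
    · rw [charFun_apply_real, integral_map hU.aemeasurable (by fun_prop)] at key
      simpa only [expI, Complex.ofReal_mul] using key
    · have := hcon t ht
      rw [edist_dist, ENNReal.ofReal_lt_ofReal_iff hε, Real.dist_eq] at this
      rwa [map_measureReal_apply hU measurableSet_Iic]

/-- Conditionally on the data, the characteristic function at `s` of the normalized deviation of a
resample estimate, based on `N` runs. -/
def resampleCharFun (ψ : ProbabilityMeasure 𝒳 → ℝ) (h : ProbabilityMeasure 𝒳 → Ξ → ℝ)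
    (ν : Measure Ξ) (n : ℕ+) (N : ℕ) (x : Fin n → 𝒳) (s : ℝ) : ℂ :=
  ∫ I, expI (s * resampleDeviation ψ n x I) *
    runCharFun ψ h ν (resampleEmpirical n x I) (s * √(n : ℝ) / N) ^ N ∂indexLaw n

lemma norm_resampleCharFun_le (n : ℕ+) (N : ℕ) (x : Fin n → 𝒳) (s : ℝ) :
    ‖resampleCharFun ψ h ν n N x s‖ ≤ 1 :=
  norm_integral_le_one fun I => by
    rw [norm_mul, norm_expI, one_mul]; exact norm_runCharFun_pow_le _ _ _

lemma IsComputation.measurable_resampleCharFun (hc : IsComputation P ψ h ν) (n : ℕ+) (N : ℕ)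
    (s : ℝ) : Measurable fun x => resampleCharFun ψ h ν n N x s := by
  have h1 : Measurable fun xI : (Fin n → 𝒳) × (Fin n → Fin n) =>
      expI (s * resampleDeviation ψ n xI.1 xI.2) :=
    measurable_expI.comp ((hc.measurable_resampleDeviation n).const_mul s)
  have h2 := ((hc.measurable_runCharFun n (s * √(n : ℝ) / N)).comp
    (measurable_resample n)).pow_const N
  exact (h1.mul h2).stronglyMeasurable.integral_prod_right'.measurable

lemma charFun_gaussianReal_zero_mul_exp (v w : ℝ≥0) (s : ℝ) :
    charFun (gaussianReal 0 v) s * (Real.exp (-(s ^ 2 * w / 2)) : ℝ) =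
      charFun (gaussianReal 0 (v + w)) s := by
  rw [charFun_gaussianReal, charFun_gaussianReal, Complex.ofReal_exp, ← Complex.exp_add]
  congr 1
  push_cast
  ring

/-- The run factor and the deviation depend on the same resample, so their conditional expectation
does not factor. Replacing the run factor by its Gaussian limit costs an error that vanishes in mean
over data and resample jointly; what remains is the bootstrap factor, and the two variances add. -/
lemma tendsto_integral_resampleCharFun (hc : IsComputation P ψ h ν) {σ : ℝ≥0}
    (hb : BootstrapValid P ψ σ) (hmom : MomentConsistent P ψ h ν) {N : ℕ+ → ℕ} {p : ℝ} (hp : 0 < p)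
    (hN : Tendsto (fun n : ℕ+ => (N n : ℝ) / (n : ℝ)) atTop (𝓝 p)) {w : ℝ≥0}
    (hw : (w : ℝ) = (runVariance h ν P).toReal / p) (s : ℝ) :
    Tendsto (fun n : ℕ+ => ∫ x, ‖resampleCharFun ψ h ν n (N n) x s -
      charFun (gaussianReal 0 (σ ^ 2 + w)) s‖ ∂dataLaw P n) atTop (𝓝 0) := by
  have t1 := tendsto_integral_charFun_resampleDeviation hc hb s
  have t2 := tendsto_integral_runCharFun_pow hc
    (X := fun n (xI : (Fin n → 𝒳) × (Fin n → Fin n)) => fun i => xI.1 (xI.2 i)) measurable_resample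
    hmom.variance_lt_top.ne hmom.thirdMoment_lt_top.ne hmom.variance_resample
    hmom.thirdMoment_resample hp hN s
  set c : ℂ := ((Real.exp (-(s ^ 2 * (runVariance h ν P).toReal / p / 2)) : ℝ) : ℂ) with hcdef
  have hc1 : ‖c‖ ≤ 1 := by
    rw [hcdef, Complex.norm_real, Real.norm_eq_abs, Real.abs_exp]
    exact Real.exp_le_one_iff.2 (neg_nonpos.2 (by positivity))
  have hg : charFun (gaussianReal 0 (σ ^ 2 + w)) s = charFun (gaussianReal 0 (σ ^ 2)) s * c := by
    rw [← charFun_gaussianReal_zero_mul_exp, hw, hcdef]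
    congr 5
    ring
  have t3 := t2.add t1
  rw [add_zero] at t3
  refine squeeze_zero (fun n => integral_nonneg fun _ => norm_nonneg _) (fun n => ?_) t3
  have mE : Measurable fun xI : (Fin n → 𝒳) × (Fin n → Fin n) =>
      expI (s * resampleDeviation ψ n xI.1 xI.2) :=
    measurable_expI.comp ((hc.measurable_resampleDeviation n).const_mul s)
  have mR : Measurable fun xI : (Fin n → 𝒳) × (Fin n → Fin n) =>
      ‖runCharFun ψ h ν (empirical n fun i => xI.1 (xI.2 i)) (s * √(n : ℝ) / N n) ^ N n - c‖ :=
    ((((hc.measurable_runCharFun n (s * √(n : ℝ) / N n)).comp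
      (measurable_resample n)).pow_const (N n)).sub_const c).norm
  have bR : ∀ Q, ‖runCharFun ψ h ν Q (s * √(n : ℝ) / N n) ^ N n - c‖ ≤ 2 := fun Q =>
    (norm_sub_le _ _).trans
      (by linarith [norm_runCharFun_pow_le (ψ := ψ) (h := h) (ν := ν) Q (s * √(n : ℝ) / N n) (N n)])
  have iR : Integrable (fun xI : (Fin n → 𝒳) × (Fin n → Fin n) =>
      ‖runCharFun ψ h ν (empirical n fun i => xI.1 (xI.2 i)) (s * √(n : ℝ) / N n) ^ N n - c‖)
      ((dataLaw P n).prod (indexLaw n)) :=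
    Integrable.of_bound mR.aestronglyMeasurable 2 (ae_of_all _ fun xI => by
      rw [norm_norm]; exact bR _)
  have iE : Integrable (fun x => ‖∫ I, expI (s * resampleDeviation ψ n x I) ∂indexLaw n -
      charFun (gaussianReal 0 (σ ^ 2)) s‖) (dataLaw P n) := by
    refine Integrable.of_bound (C := 2)
      (mE.stronglyMeasurable.integral_prod_right'.measurable.sub_const
        _).norm.aestronglyMeasurable (ae_of_all _ fun x => ?_)
    rw [norm_norm]
    refine (norm_sub_le _ _).trans ?_
    have h1 := norm_integral_le_one (μ := indexLaw n)
      (f := fun I => expI (s * resampleDeviation ψ n x I)) fun I => (norm_expI _).le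
    have h2 := norm_charFun_le_one (μ := gaussianReal 0 (σ ^ 2)) s
    linarith
  rw [integral_prod _ iR, ← integral_add iR.integral_prod_left iE]
  refine integral_mono_of_nonneg (ae_of_all _ fun _ => norm_nonneg _)
    (iR.integral_prod_left.add iE) (ae_of_all _ fun x => ?_)
  have i1 : Integrable (fun I => expI (s * resampleDeviation ψ n x I)) (indexLaw n) :=
    integrable_expI (measurable_of_countable _)
  have i2 : Integrable (fun I => expI (s * resampleDeviation ψ n x I) *
      runCharFun ψ h ν (resampleEmpirical n x I) (s * √(n : ℝ) / N n) ^ N n) (indexLaw n) :=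
    Integrable.of_bound (measurable_of_countable _).aestronglyMeasurable 1 (ae_of_all _ fun I => by
      rw [norm_mul, norm_expI, one_mul]; exact norm_runCharFun_pow_le _ _ _)
  have e : resampleCharFun ψ h ν n (N n) x s - charFun (gaussianReal 0 (σ ^ 2 + w)) s =
      ∫ I, (expI (s * resampleDeviation ψ n x I) *
        runCharFun ψ h ν (resampleEmpirical n x I) (s * √(n : ℝ) / N n) ^ N n -
        expI (s * resampleDeviation ψ n x I) * c) ∂indexLaw n +
      (∫ I, expI (s * resampleDeviation ψ n x I) ∂indexLaw n -
        charFun (gaussianReal 0 (σ ^ 2)) s) * c := by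
    rw [integral_sub i2 (i1.mul_const c), integral_mul_const, hg, resampleCharFun]
    ring
  dsimp only
  rw [e]
  refine (norm_add_le _ _).trans (add_le_add ?_ ?_)
  · refine (norm_integral_le_integral_norm _).trans (le_of_eq (integral_congr_ae
      (ae_of_all _ fun I => ?_)))
    dsimp only
    rw [← mul_sub, norm_mul, norm_expI, one_mul]
    rfl
  · rw [norm_mul]
    exact mul_le_of_le_one_right (norm_nonneg _) hc1

end

section

variable {𝒳 Ξ : Type*} [MeasurableSpace 𝒳] {P : ProbabilityMeasure 𝒳}
  {ψ : ProbabilityMeasure 𝒳 → ℝ} {h : ProbabilityMeasure 𝒳 → Ξ → ℝ}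

/-! ### The joint law of the normalized errors -/

/-- The normalized errors of the original estimate (with respect to the target) and of the resample
estimates (with respect to the value at the empirical distribution). -/
def normalizedErrors (P : ProbabilityMeasure 𝒳) (ψ : ProbabilityMeasure 𝒳 → ℝ)
    (h : ProbabilityMeasure 𝒳 → Ξ → ℝ) {B : ℕ} {n : ℕ+} {R₀ R : ℕ} (ω : Outcome 𝒳 Ξ B n R₀ R) :
    WithLp 2 (ℝ × EuclideanSpace ℝ (Fin B)) :=
  WithLp.toLp 2 (√(n : ℝ) * (pointEstimate h ω - ψ P),
    WithLp.toLp 2 fun b => √(n : ℝ) * (resampleEstimate h ω b - ψ (empirical n ω.1)))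

variable {B : ℕ} {n : ℕ+} {R₀ R : ℕ}

/-- Splitting each error into its statistical part and an average of centered runs gives one factor
per independent source of randomness. The sizes must be nonzero because an empty average is 0 and
cannot be recentered. -/
lemma expI_inner_normalizedErrors (hR₀ : R₀ ≠ 0) (hR : R ≠ 0)
    (t : WithLp 2 (ℝ × EuclideanSpace ℝ (Fin B))) (x : Fin n → 𝒳) (I : Fin B → Fin n → Fin n)
    (ξ₀ : Fin R₀ → Ξ) (ξ : Fin B → Fin R → Ξ) :
    expI (inner ℝ (normalizedErrors P ψ h ((x, I, ξ₀, ξ) : Outcome 𝒳 Ξ B n R₀ R)) t) =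
      expI (t.fst * (√(n : ℝ) * (ψ (empirical n x) - ψ P))) *
      ((∏ r, expI (t.fst * √(n : ℝ) / R₀ * (h (empirical n x) (ξ₀ r) - ψ (empirical n x)))) *
      ∏ b, (expI (t.snd b * resampleDeviation ψ n x (I b)) *
        ∏ r, expI (t.snd b * √(n : ℝ) / R *
          (h (resampleEmpirical n x (I b)) (ξ b r) - ψ (resampleEmpirical n x (I b)))))) := by
  simp_rw [← expI_sum, ← expI_add, ← expI_sum, ← expI_add]
  congr 1
  have hR₀' : (R₀ : ℝ) ≠ 0 := by exact_mod_cast hR₀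
  have hR' : (R : ℝ) ≠ 0 := by exact_mod_cast hR
  rw [WithLp.prod_inner_apply, PiLp.inner_apply, ← add_assoc]
  congr 1
  · simp only [normalizedErrors, pointEstimate, RCLike.inner_apply, conj_trivial]
    rw [← Finset.mul_sum, Finset.sum_sub_distrib]
    simp only [Finset.sum_const, Finset.card_univ, Fintype.card_fin, nsmul_eq_mul]
    change t.fst * _ = _
    field_simp
    ring
  · refine Finset.sum_congr rfl fun b _ => ?_
    simp only [normalizedErrors, resampleEstimate, RCLike.inner_apply, conj_trivial,
      resampleDeviation]
    rw [← Finset.mul_sum, Finset.sum_sub_distrib]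
    simp only [Finset.sum_const, Finset.card_univ, Fintype.card_fin, nsmul_eq_mul]
    change t.snd b * _ = _
    field_simp
    ring

variable [MeasurableSpace Ξ] {ν : Measure Ξ}

instance [IsProbabilityMeasure ν] (P : ProbabilityMeasure 𝒳) (B : ℕ) (n : ℕ+) (R₀ R : ℕ) :
    IsProbabilityMeasure (nestedLaw P ν B n R₀ R) := by
  unfold nestedLaw; infer_instance

lemma IsComputation.measurable_pointEstimate (hc : IsComputation P ψ h ν) :
    Measurable fun ω : Outcome 𝒳 Ξ B n R₀ R => pointEstimate h ω := by
  refine (Finset.measurable_sum _ fun r _ => ?_).const_mul _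
  have : Measurable fun ω : Outcome 𝒳 Ξ B n R₀ R => (ω.1, ω.2.2.1 r) := by fun_prop
  exact ((hc.measurable_run n).comp this :)

lemma IsComputation.measurable_resampleEstimate (hc : IsComputation P ψ h ν) (b : Fin B) :
    Measurable fun ω : Outcome 𝒳 Ξ B n R₀ R => resampleEstimate h ω b := by
  refine (Finset.measurable_sum _ fun r _ => ?_).const_mul _
  have h1 : Measurable fun ω : Outcome 𝒳 Ξ B n R₀ R => (ω.1, ω.2.1 b) := by fun_prop
  have h2 : Measurable fun ω : Outcome 𝒳 Ξ B n R₀ R => ω.2.2.2 b r := by fun_prop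
  exact ((hc.measurable_run n).comp (((measurable_resample n).comp h1).prodMk h2) :)

lemma IsComputation.measurable_normalizedErrors [IsProbabilityMeasure ν] (hc : IsComputation P ψ h ν) :
    Measurable fun ω : Outcome 𝒳 Ξ B n R₀ R => normalizedErrors P ψ h ω := by
  have h1 := hc.measurable_pointEstimate (B := B) (n := n) (R₀ := R₀) (R := R)
  have h2 := hc.measurable_resampleEstimate (B := B) (n := n) (R₀ := R₀) (R := R)
  have h3 : Measurable fun ω : Outcome 𝒳 Ξ B n R₀ R => ψ (empirical n ω.1) :=
    (hc.measurable_functional n).comp measurable_fst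
  refine (WithLp.measurable_toLp 2 _).comp (((h1.sub_const _).const_mul _).prodMk ?_)
  exact (WithLp.measurable_toLp 2 _).comp
    (measurable_pi_lambda _ fun b => ((h2 b).sub h3).const_mul _)

/-- Fubini from the inside out: the runs integrate to powers of `runCharFun`, then the independent
resample indices give a product over b, and the data remain. -/
lemma charFun_map_normalizedErrors [IsProbabilityMeasure ν] (hc : IsComputation P ψ h ν) (hR₀ : R₀ ≠ 0) (hR : R ≠ 0)
    (t : WithLp 2 (ℝ × EuclideanSpace ℝ (Fin B))) :
    charFun ((nestedLaw P ν B n R₀ R).map (normalizedErrors P ψ h)) t =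
      ∫ x, expI (t.fst * (√(n : ℝ) * (ψ (empirical n x) - ψ P))) *
        (runCharFun ψ h ν (empirical n x) (t.fst * √(n : ℝ) / R₀) ^ R₀ *
          ∏ b, resampleCharFun ψ h ν n R x (t.snd b)) ∂dataLaw P n := by
  have hV := hc.measurable_normalizedErrors (B := B) (n := n) (R₀ := R₀) (R := R)
  have hin : Measurable fun ω : Outcome 𝒳 Ξ B n R₀ R => inner ℝ (normalizedErrors P ψ h ω) t :=
    hV.inner_const
  rw [charFun_apply, integral_map hV.aemeasurable (by fun_prop)]
  change ∫ ω, expI (inner ℝ (normalizedErrors P ψ h ω) t) ∂nestedLaw P ν B n R₀ R = _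
  rw [nestedLaw, integral_prod _ (integrable_expI hin)]
  refine integral_congr_ae (ae_of_all _ fun x => ?_)
  dsimp only
  have hinx : Measurable fun y => inner ℝ (normalizedErrors P ψ h ((x, y) : Outcome 𝒳 Ξ B n R₀ R)) t :=
    hin.comp measurable_prodMk_left
  rw [integral_prod _ (integrable_expI hinx)]
  simp_rw [expI_inner_normalizedErrors hR₀ hR, integral_const_mul]
  congr 1
  have hK : ∀ I : Fin B → Fin n → Fin n,
      ∫ ξ : (Fin R₀ → Ξ) × (Fin B → Fin R → Ξ),
        ((∏ r, expI (t.fst * √(n : ℝ) / R₀ * (h (empirical n x) (ξ.1 r) - ψ (empirical n x)))) *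
        ∏ b, (expI (t.snd b * resampleDeviation ψ n x (I b)) *
          ∏ r, expI (t.snd b * √(n : ℝ) / R *
            (h (resampleEmpirical n x (I b)) (ξ.2 b r) - ψ (resampleEmpirical n x (I b))))))
        ∂((Measure.pi fun _ : Fin R₀ => ν).prod
          (Measure.pi fun _ : Fin B => Measure.pi fun _ : Fin R => ν)) =
      runCharFun ψ h ν (empirical n x) (t.fst * √(n : ℝ) / R₀) ^ R₀ *
        ∏ b, (expI (t.snd b * resampleDeviation ψ n x (I b)) *
          runCharFun ψ h ν (resampleEmpirical n x (I b)) (t.snd b * √(n : ℝ) / R) ^ R) := by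
    intro I
    have e1 := integral_prod_mul (μ := Measure.pi fun _ : Fin R₀ => ν)
      (ν := Measure.pi fun _ : Fin B => Measure.pi fun _ : Fin R => ν)
      (fun ξ₀ : Fin R₀ → Ξ => ∏ r, expI (t.fst * √(n : ℝ) / R₀ *
        (h (empirical n x) (ξ₀ r) - ψ (empirical n x))))
      (fun ξ : Fin B → Fin R → Ξ => ∏ b, (expI (t.snd b * resampleDeviation ψ n x (I b)) *
          ∏ r, expI (t.snd b * √(n : ℝ) / R *
            (h (resampleEmpirical n x (I b)) (ξ b r) - ψ (resampleEmpirical n x (I b))))))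
    rw [e1]
    congr 1
    · rw [integral_fintype_prod_eq_pow (fun ξ => expI (t.fst * √(n : ℝ) / R₀ *
        (h (empirical n x) ξ - ψ (empirical n x)))), Fintype.card_fin]
      rfl
    · rw [integral_fintype_prod_eq_prod (fun b (ξ : Fin R → Ξ) =>
        expI (t.snd b * resampleDeviation ψ n x (I b)) *
          ∏ r, expI (t.snd b * √(n : ℝ) / R *
            (h (resampleEmpirical n x (I b)) (ξ r) - ψ (resampleEmpirical n x (I b)))))]
      refine Finset.prod_congr rfl fun b _ => ?_
      rw [integral_const_mul, integral_fintype_prod_eq_pow (fun ξ => expI (t.snd b * √(n : ℝ) / R *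
            (h (resampleEmpirical n x (I b)) ξ - ψ (resampleEmpirical n x (I b))))),
        Fintype.card_fin]
      rfl
  simp_rw [hK, integral_const_mul]
  congr 1
  exact integral_fintype_prod_eq_prod (fun b (J : Fin n → Fin n) =>
    expI (t.snd b * resampleDeviation ψ n x J) *
      runCharFun ψ h ν (resampleEmpirical n x J) (t.snd b * √(n : ℝ) / R) ^ R)

end

/-! ### Asymptotic independence and the joint Gaussian limit. -/

section

variable {𝒳 Ξ : Type*} [MeasurableSpace 𝒳] [MeasurableSpace Ξ]
  {ψ : ProbabilityMeasure 𝒳 → ℝ} {h : ProbabilityMeasure 𝒳 → Ξ → ℝ} {ν : Measure Ξ}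
  [IsProbabilityMeasure ν] {P : ProbabilityMeasure 𝒳}

lemma tendsto_integral_expI_original (hc : IsComputation P ψ h ν) {σ : ℝ≥0}
    (hb : BootstrapValid P ψ σ) (s : ℝ) :
    Tendsto (fun n : ℕ+ => ∫ x, expI (s * (√(n : ℝ) * (ψ (empirical n x) - ψ P))) ∂dataLaw P n) atTop
      (𝓝 (charFun (gaussianReal 0 (σ ^ 2)) s)) := by
  have h1 := (ProbabilityMeasure.tendsto_iff_forall_integral_rclike_tendsto ℂ).1
    hb.original.tendsto (BoundedContinuousFunction.innerProbChar s)
  simp only [ProbabilityMeasure.coe_mk, ← charFun_eq_integral_innerProbChar, Measure.map_id] at h1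
  convert h1 using 2 with n
  have hm : Measurable fun x : Fin n → 𝒳 => √(n : ℝ) * (ψ (empirical n x) - ψ P) :=
    ((hc.measurable_functional n).sub_const _).const_mul _
  rw [charFun_apply_real, integral_map hm.aemeasurable (by fun_prop)]
  simp only [expI, Complex.ofReal_mul]

/-- All factors lie in the unit disc, so replacing the run factor and the resample factors by their
constant limits costs at most the sum of their mean errors. The constants then leave the integral,
and only the factor of the original statistical error is integrated over the data. -/
lemma tendsto_charFun_normalizedErrors (hc : IsComputation P ψ h ν) {σ : ℝ≥0}
    (hb : BootstrapValid P ψ σ) (hmom : MomentConsistent P ψ h ν) {R₀ R : ℕ+ → ℕ} {p₀ p : ℝ}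
    (hp₀ : 0 < p₀) (hp : 0 < p)
    (hR₀ : Tendsto (fun n : ℕ+ => (R₀ n : ℝ) / (n : ℝ)) atTop (𝓝 p₀))
    (hR : Tendsto (fun n : ℕ+ => (R n : ℝ) / (n : ℝ)) atTop (𝓝 p)) {w₀ w : ℝ≥0}
    (hw₀ : (w₀ : ℝ) = (runVariance h ν P).toReal / p₀)
    (hw : (w : ℝ) = (runVariance h ν P).toReal / p) {B : ℕ}
    (t : WithLp 2 (ℝ × EuclideanSpace ℝ (Fin B))) :
    Tendsto (fun n : ℕ+ => charFun ((nestedLaw P ν B n (R₀ n) (R n)).map (normalizedErrors P ψ h)) t)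
      atTop (𝓝 (charFun (gaussianReal 0 (σ ^ 2 + w₀)) t.fst *
        ∏ b, charFun (gaussianReal 0 (σ ^ 2 + w)) (t.snd b))) := by
  have tχ := tendsto_integral_runCharFun_pow hc (X := fun n (x : Fin n → 𝒳) => x)
    (fun n => measurable_id) hmom.variance_lt_top.ne hmom.thirdMoment_lt_top.ne
    hmom.variance_original hmom.thirdMoment_original hp₀ hR₀ t.fst
  have tG := fun b => tendsto_integral_resampleCharFun hc hb hmom hp hR hw (t.snd b)
  have tU := tendsto_integral_expI_original hc hb t.fst
  set c₀ : ℂ := ((Real.exp (-(t.fst ^ 2 * (runVariance h ν P).toReal / p₀ / 2)) : ℝ) : ℂ) with hc₀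
  set g : Fin B → ℂ := fun b => charFun (gaussianReal 0 (σ ^ 2 + w)) (t.snd b) with hg
  have hc₀1 : ‖c₀‖ ≤ 1 := by
    rw [hc₀, Complex.norm_real, Real.norm_eq_abs, Real.abs_exp]
    exact Real.exp_le_one_iff.2 (neg_nonpos.2 (by positivity))
  have hg1 : ∀ b, ‖g b‖ ≤ 1 := fun b => norm_charFun_le_one _
  have hprod : ‖∏ b, g b‖ ≤ 1 := by
    rw [norm_prod]; exact Finset.prod_le_one (fun _ _ => norm_nonneg _) fun b _ => hg1 b
  have hlim : charFun (gaussianReal 0 (σ ^ 2 + w₀)) t.fst * ∏ b, g b =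
      charFun (gaussianReal 0 (σ ^ 2)) t.fst * (c₀ * ∏ b, g b) := by
    rw [← charFun_gaussianReal_zero_mul_exp, hw₀, hc₀, ← mul_assoc]
    congr 6
    ring
  rw [hlim, tendsto_iff_norm_sub_tendsto_zero]
  rw [tendsto_iff_norm_sub_tendsto_zero] at tU
  have tS := (tχ.add (tendsto_finsetSum Finset.univ fun b _ => tG b)).add tU
  simp only [Finset.sum_const_zero, add_zero] at tS
  refine squeeze_zero' (Eventually.of_forall fun _ => norm_nonneg _) ?_ tS
  have hpos : ∀ {N : ℕ+ → ℕ} {q : ℝ}, 0 < q →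
      Tendsto (fun n : ℕ+ => (N n : ℝ) / (n : ℝ)) atTop (𝓝 q) → ∀ᶠ n in atTop, N n ≠ 0 := by
    intro N q hq hN
    filter_upwards [hN.eventually_const_lt hq] with n hn h0
    simp [h0] at hn
  filter_upwards [hpos hp₀ hR₀, hpos hp hR] with n h0 h1
  rw [charFun_map_normalizedErrors hc h0 h1]
  set E : (Fin n → 𝒳) → ℂ := fun x => expI (t.fst * (√(n : ℝ) * (ψ (empirical n x) - ψ P)))
  set χ : (Fin n → 𝒳) → ℂ := fun x =>
    runCharFun ψ h ν (empirical n x) (t.fst * √(n : ℝ) / R₀ n) ^ R₀ n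
  set G : Fin B → (Fin n → 𝒳) → ℂ := fun b x => resampleCharFun ψ h ν n (R n) x (t.snd b)
  have mE : Measurable fun x : Fin n → 𝒳 => t.fst * (√(n : ℝ) * (ψ (empirical n x) - ψ P)) :=
    (((hc.measurable_functional n).sub_const _).const_mul _).const_mul _
  have mχ : Measurable χ := (hc.measurable_runCharFun n _).pow_const _
  have mG : ∀ b, Measurable (G b) := fun b => hc.measurable_resampleCharFun n _ _
  have bχ : ∀ x, ‖χ x‖ ≤ 1 := fun x => norm_runCharFun_pow_le _ _ _
  have bG : ∀ b x, ‖G b x‖ ≤ 1 := fun b x => norm_resampleCharFun_le _ _ _ _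
  have iE : Integrable E (dataLaw P n) := integrable_expI mE
  have bGp : ∀ x, ‖∏ b, G b x‖ ≤ 1 := fun x => by
    rw [norm_prod]; exact Finset.prod_le_one (fun _ _ => norm_nonneg _) fun b _ => bG b x
  have iF : Integrable (fun x => E x * (χ x * ∏ b, G b x)) (dataLaw P n) := by
    refine Integrable.of_bound (C := 1) ((measurable_expI.comp mE).mul (mχ.mul
      (Finset.measurable_prod _ fun b _ => mG b))).aestronglyMeasurable (ae_of_all _ fun x => ?_)
    rw [norm_mul, norm_mul, norm_expI, one_mul]
    exact mul_le_one₀ (bχ x) (norm_nonneg _) (bGp x)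
  have iχ : Integrable (fun x => ‖χ x - c₀‖) (dataLaw P n) :=
    ((Integrable.of_bound mχ.aestronglyMeasurable 1 (ae_of_all _ bχ)).sub (integrable_const _)).norm
  have iG : ∀ b, Integrable (fun x => ‖G b x - g b‖) (dataLaw P n) := fun b =>
    ((Integrable.of_bound (mG b).aestronglyMeasurable 1 (ae_of_all _ (bG b))).sub
      (integrable_const _)).norm
  have e : ∫ x, E x * (χ x * ∏ b, G b x) ∂dataLaw P n -
      charFun (gaussianReal 0 (σ ^ 2)) t.fst * (c₀ * ∏ b, g b) =
      ∫ x, (E x * (χ x * ∏ b, G b x) - E x * (c₀ * ∏ b, g b)) ∂dataLaw P n +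
      (∫ x, E x ∂dataLaw P n - charFun (gaussianReal 0 (σ ^ 2)) t.fst) * (c₀ * ∏ b, g b) := by
    rw [integral_sub iF (iE.mul_const _), integral_mul_const]
    ring
  rw [e]
  refine (norm_add_le _ _).trans (add_le_add ?_ ?_)
  · rw [← integral_finsetSum _ fun b _ => iG b,
      ← integral_add iχ (integrable_finsetSum _ fun b _ => iG b)]
    refine (norm_integral_le_integral_norm _).trans (integral_mono_of_nonneg
      (ae_of_all _ fun _ => norm_nonneg _)
      (iχ.add (integrable_finsetSum _ fun b _ => iG b)) (ae_of_all _ fun x => ?_))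
    dsimp only
    rw [← mul_sub, norm_mul, norm_expI, one_mul]
    have e2 : χ x * ∏ b, G b x - c₀ * ∏ b, g b =
        (χ x - c₀) * ∏ b, G b x + c₀ * (∏ b, G b x - ∏ b, g b) := by ring
    rw [e2]
    refine (norm_add_le _ _).trans ?_
    rw [norm_mul, norm_mul]
    refine add_le_add (mul_le_of_le_one_right (norm_nonneg _) (bGp x)) ?_
    exact (mul_le_of_le_one_left (norm_nonneg _) hc₀1).trans
      (norm_finset_prod_sub_prod_le _ (fun b => bG b x) hg1)
  · rw [norm_mul, norm_mul]
    exact mul_le_of_le_one_right (norm_nonneg _) (mul_le_one₀ hc₀1 (norm_nonneg _) hprod)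

/-- The limit law of the normalized errors: independent centered Gaussian variables, the first one
of variance `v₀`, the others of variance `v`. -/
def gaussianLimit (B : ℕ) (v₀ v : ℝ≥0) : ProbabilityMeasure (WithLp 2 (ℝ × EuclideanSpace ℝ (Fin B))) :=
  ⟨((gaussianReal 0 v₀).prod ((Measure.pi fun _ : Fin B => gaussianReal 0 v).map
      (WithLp.toLp 2))).map (WithLp.toLp 2), by
    have h1 : IsProbabilityMeasure ((Measure.pi fun _ : Fin B => gaussianReal 0 v).map
      (WithLp.toLp 2)) :=
      Measure.isProbabilityMeasure_map (WithLp.measurable_toLp 2 _).aemeasurable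
    exact Measure.isProbabilityMeasure_map (WithLp.measurable_toLp 2 _).aemeasurable⟩

/-- The law of the normalized errors, as a probability measure. -/
def normalizedErrorsLaw (hc : IsComputation P ψ h ν) (B : ℕ) (n : ℕ+) (R₀ R : ℕ) :
    ProbabilityMeasure (WithLp 2 (ℝ × EuclideanSpace ℝ (Fin B))) :=
  ⟨(nestedLaw P ν B n R₀ R).map (normalizedErrors P ψ h),
    Measure.isProbabilityMeasure_map hc.measurable_normalizedErrors.aemeasurable⟩

/-- Reindexes by ℕ, the form in which Lévy's continuity theorem is applied. -/
lemma map_succPNat_atTop : map Nat.succPNat atTop = atTop :=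
  OrderIso.pnatIsoNat.symm.map_atTop

lemma tendsto_normalizedErrorsLaw (hc : IsComputation P ψ h ν) {σ : ℝ≥0}
    (hb : BootstrapValid P ψ σ) (hmom : MomentConsistent P ψ h ν) {R₀ R : ℕ+ → ℕ} {p₀ p : ℝ}
    (hp₀ : 0 < p₀) (hp : 0 < p)
    (hR₀ : Tendsto (fun n : ℕ+ => (R₀ n : ℝ) / (n : ℝ)) atTop (𝓝 p₀))
    (hR : Tendsto (fun n : ℕ+ => (R n : ℝ) / (n : ℝ)) atTop (𝓝 p)) {w₀ w : ℝ≥0}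
    (hw₀ : (w₀ : ℝ) = (runVariance h ν P).toReal / p₀)
    (hw : (w : ℝ) = (runVariance h ν P).toReal / p) (B : ℕ) :
    Tendsto (fun n : ℕ+ => normalizedErrorsLaw hc B n (R₀ n) (R n)) atTop
      (𝓝 (gaussianLimit B (σ ^ 2 + w₀) (σ ^ 2 + w))) := by
  rw [← map_succPNat_atTop, tendsto_map'_iff]
  refine ProbabilityMeasure.tendsto_of_tendsto_charFun fun t => ?_
  have ht := (tendsto_charFun_normalizedErrors hc hb hmom hp₀ hp hR₀ hR hw₀ hw t)
  rw [← map_succPNat_atTop, tendsto_map'_iff] at ht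
  have e : charFun (gaussianLimit B (σ ^ 2 + w₀) (σ ^ 2 + w) : Measure _) t =
      charFun (gaussianReal 0 (σ ^ 2 + w₀)) t.fst *
        ∏ b, charFun (gaussianReal 0 (σ ^ 2 + w)) (t.snd b) := by
    have h1 : IsProbabilityMeasure ((Measure.pi fun _ : Fin B => gaussianReal 0 (σ ^ 2 + w)).map
      (WithLp.toLp 2)) :=
      Measure.isProbabilityMeasure_map (WithLp.measurable_toLp 2 _).aemeasurable
    refine (charFun_prod t).trans ?_
    rw [charFun_pi]
    rfl
  rw [e]
  exact ht

end

section

/-! ### Quantiles of atomless symmetric distributions -/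

lemma continuous_cdf (μ : Measure ℝ) [IsProbabilityMeasure μ] [NullSingletonClass μ] : Continuous (cdf μ) := by
  refine continuous_iff_continuousAt.2 fun x => ?_
  rw [(monotone_cdf μ).continuousAt_iff_leftLim_eq_rightLim, StieltjesFunction.rightLim_eq]
  have h0 : (cdf μ).measure {x} = 0 := by rw [measure_cdf]; exact measure_singleton x
  rw [StieltjesFunction.measure_singleton, ENNReal.ofReal_eq_zero] at h0
  exact le_antisymm ((monotone_cdf μ).leftLim_le le_rfl) (by linarith)

/-- Continuity is used twice: the infimum is attained, giving ≥ p, and below it the distribution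
function is < p, giving ≤ p in the limit from the left. -/
lemma measureReal_Iic_quantile (μ : Measure ℝ) [IsProbabilityMeasure μ] [NullSingletonClass μ] {p : ℝ}
    (hp : 0 < p) (hp' : p < 1) : μ.real (Set.Iic (quantile μ p)) = p := by
  have hc := continuous_cdf μ
  have hS : {q : ℝ | p ≤ μ.real (Set.Iic q)} = {q : ℝ | p ≤ cdf μ q} := by
    simp only [cdf_eq_real]
  rw [quantile, hS, ← cdf_eq_real]
  have hne : {q : ℝ | p ≤ cdf μ q}.Nonempty :=
    ((tendsto_cdf_atTop μ).eventually_const_le hp').exists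
  obtain ⟨a, ha⟩ := ((tendsto_cdf_atBot μ).eventually_lt_const hp).exists
  have hbdd : BddBelow {q : ℝ | p ≤ cdf μ q} :=
    ⟨a, fun q hq => le_of_not_gt fun h => (((monotone_cdf μ) h.le).trans_lt ha).not_ge hq⟩
  have hclosed : IsClosed {q : ℝ | p ≤ cdf μ q} := isClosed_le continuous_const hc
  refine le_antisymm ?_ (hclosed.csInf_mem hne hbdd)
  refine le_of_tendsto (hc.continuousAt.tendsto.mono_left
    (nhdsWithin_le_nhds (s := Set.Iio (sInf {q : ℝ | p ≤ cdf μ q})))) ?_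
  filter_upwards [self_mem_nhdsWithin] with q hq
  exact le_of_not_ge fun h => absurd (csInf_le hbdd h) (not_le.2 hq)

lemma measureReal_Icc_neg_of_symmetric (μ : Measure ℝ) [IsProbabilityMeasure μ]
    (hμ : μ.map (fun x => -x) = μ) {t : ℝ} (ht : 0 ≤ t) :
    μ.real (Set.Icc (-t) t) = 2 * μ.real (Set.Iic t) - 1 := by
  have h1 : μ.real (Set.Iio (-t)) = μ.real (Set.Ioi t) := by
    conv_lhs => rw [← hμ]
    rw [map_measureReal_apply measurable_neg measurableSet_Iio]
    congr 1
    ext x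
    simp
  have h2 : μ.real (Set.Ioi t) = 1 - μ.real (Set.Iic t) := by
    rw [← Set.compl_Iic, probReal_compl_eq_one_sub measurableSet_Iic]
  have h3 : Set.Iic t \ Set.Iio (-t) = Set.Icc (-t) t := by
    ext x; simp [and_comm]
  have hsub : Set.Iio (-t) ⊆ Set.Iic t := fun x hx => by
    rw [Set.mem_Iio] at hx
    rw [Set.mem_Iic]
    linarith
  rw [← h3, measureReal_sdiff hsub measurableSet_Iio, h1, h2]
  ring

/-- Were t negative, (-∞, t] and [-t, ∞) would be disjoint sets of equal mass above 1/2. -/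
lemma nonneg_of_symmetric_of_half_lt (μ : Measure ℝ) [IsProbabilityMeasure μ]
    (hμ : μ.map (fun x => -x) = μ) {t : ℝ} (ht : 1 / 2 < μ.real (Set.Iic t)) : 0 ≤ t := by
  by_contra hcon
  have h1 : μ.real (Set.Iic t) = μ.real (Set.Ici (-t)) := by
    conv_lhs => rw [← hμ]
    rw [map_measureReal_apply measurable_neg measurableSet_Iic]
    congr 1
    ext x
    simp
  have hd : Disjoint (Set.Iic t) (Set.Ici (-t)) := by
    rw [Set.disjoint_left]
    intro x hx hx'
    have h2 : x ≤ t := hx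
    have h3 : -t ≤ x := hx'
    linarith
  have h2 := measureReal_union (μ := μ) hd measurableSet_Ici
  have h3 : μ.real (Set.Iic t ∪ Set.Ici (-t)) ≤ 1 := measureReal_le_one
  linarith

/-! ### Student's distribution -/

lemma measurable_sum_sq_div (k : ℕ) : Measurable fun v : Fin k → ℝ => (∑ i, v i ^ 2) / k := by
  fun_prop

lemma measurable_studentRatio (k : ℕ) :
    Measurable fun zv : ℝ × (Fin k → ℝ) => zv.1 / √((∑ i, zv.2 i ^ 2) / k) := by
  fun_prop

instance (k : ℕ) : IsProbabilityMeasure (studentT k) :=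
  Measure.isProbabilityMeasure_map (measurable_studentRatio k).aemeasurable

lemma ae_sum_sq_div_pos {k : ℕ} (hk : k ≠ 0) :
    ∀ᵐ v ∂(Measure.pi fun _ : Fin k => gaussianReal 0 1), 0 < (∑ i, v i ^ 2) / (k : ℝ) := by
  have hk' : 0 < k := Nat.pos_of_ne_zero hk
  have h0 : ∀ᵐ z ∂gaussianReal 0 1, z ≠ 0 := by
    have := nullSingletonClass_gaussianReal (μ := 0) (v := 1) one_ne_zero
    simp [ae_iff]
  have h1 := (measurePreserving_eval (fun _ : Fin k => gaussianReal 0 1) ⟨0, hk'⟩).quasiMeasurePreserving.ae h0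
  filter_upwards [h1] with v hv
  have h2 : 0 < ∑ i, v i ^ 2 :=
    Finset.sum_pos' (fun i _ => sq_nonneg _) ⟨⟨0, hk'⟩, Finset.mem_univ _, by positivity⟩
  positivity

/-- Given an almost surely positive denominator, a fixed value of the ratio pins the Gaussian
numerator to one point. -/
lemma nullSingletonClass_studentT {k : ℕ} (hk : k ≠ 0) : NullSingletonClass (studentT k) := by
  have := nullSingletonClass_gaussianReal (μ := 0) (v := 1) one_ne_zero
  refine ⟨fun c => ?_⟩
  rw [studentT, Measure.map_apply (measurable_studentRatio k) (measurableSet_singleton c),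
    Measure.prod_apply_symm (measurable_studentRatio k (measurableSet_singleton c)),
    lintegral_eq_zero_iff' ((measurable_measure_prodMk_right
      (measurable_studentRatio k (measurableSet_singleton c))).aemeasurable)]
  filter_upwards [ae_sum_sq_div_pos hk] with v hv
  refine measure_mono_null (t := {c * √((∑ i, v i ^ 2) / k)}) (fun z hz => ?_)
    (measure_singleton _)
  have hz' : z / √((∑ i, v i ^ 2) / k) = c := hz
  rw [Set.mem_singleton_iff, ← hz', div_mul_cancel₀]
  exact (Real.sqrt_pos.2 hv).ne'

lemma map_neg_studentT (k : ℕ) : (studentT k).map (fun x => -x) = studentT k := by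
  have hneg : MeasurePreserving (fun x : ℝ => -x) (gaussianReal 0 1) (gaussianReal 0 1) :=
    ⟨measurable_neg, by rw [gaussianReal_map_neg, neg_zero]⟩
  have hp := hneg.prod (MeasurePreserving.id (Measure.pi fun _ : Fin k => gaussianReal 0 1))
  rw [studentT, Measure.map_map measurable_neg (measurable_studentRatio k)]
  conv_rhs => rw [← hp.map_eq]
  rw [Measure.map_map (measurable_studentRatio k) hp.measurable]
  congr 1
  ext zv
  simp [neg_div]

lemma measureReal_Icc_quantile_studentT {k : ℕ} (hk : k ≠ 0) {α : ℝ} (hα₀ : 0 < α) (hα₁ : α < 1) :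
    0 ≤ quantile (studentT k) (1 - α / 2) ∧
      (studentT k).real (Set.Icc (-quantile (studentT k) (1 - α / 2))
        (quantile (studentT k) (1 - α / 2))) = 1 - α := by
  have := nullSingletonClass_studentT hk
  have hq := measureReal_Iic_quantile (studentT k) (p := 1 - α / 2) (by linarith) (by linarith)
  have ht := nonneg_of_symmetric_of_half_lt _ (map_neg_studentT k) (by rw [hq]; linarith)
  refine ⟨ht, ?_⟩
  rw [measureReal_Icc_neg_of_symmetric _ (map_neg_studentT k) ht, hq]
  ring

/-! ### The sample variance of a Gaussian sample -/

/-- The sample variance of a finite family of real numbers. -/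
def sampleVar {B : ℕ} (y : Fin B → ℝ) : ℝ :=
  (1 / ((B : ℝ) - 1)) * ∑ b, (y b - (1 / (B : ℝ)) * ∑ c, y c) ^ 2

lemma continuous_sampleVar (B : ℕ) : Continuous (sampleVar : (Fin B → ℝ) → ℝ) := by
  unfold sampleVar; fun_prop

/-- Shift invariance lets the resample errors be centered at the unobservable value of ψ at the
empirical distribution; scaling takes care of √n and of the Gaussian standard deviation. -/
lemma sampleVar_mul_sub {B : ℕ} (c a : ℝ) (y : Fin B → ℝ) :
    sampleVar (fun b => c * (y b - a)) = c ^ 2 * sampleVar y := by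
  rcases Nat.eq_zero_or_pos B with rfl | hB
  · simp [sampleVar]
  have hB' : (B : ℝ) ≠ 0 := by exact_mod_cast hB.ne'
  have e : ∀ b, c * (y b - a) - (1 / (B : ℝ)) * ∑ d, c * (y d - a) =
      c * (y b - (1 / (B : ℝ)) * ∑ d, y d) := by
    intro b
    rw [← Finset.mul_sum, Finset.sum_sub_distrib]
    simp only [Finset.sum_const, Finset.card_univ, Fintype.card_fin, nsmul_eq_mul]
    field_simp
    ring
  rw [sampleVar, sampleVar, Finset.sum_congr rfl fun b _ => by rw [e b, mul_pow], ← Finset.mul_sum]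
  ring

lemma sampleVar_eq_norm_sq_sub {k : ℕ} (y : Fin (k + 1) → ℝ) :
    sampleVar y = (∑ i, y i ^ 2 - (∑ i, y i) ^ 2 / (k + 1)) / k := by
  have hk : (k : ℝ) + 1 ≠ 0 := by positivity
  simp only [sampleVar, sub_sq, Finset.sum_add_distrib, Finset.sum_sub_distrib, ← Finset.sum_mul,
    ← Finset.mul_sum]
  simp only [Finset.sum_const, Finset.card_univ, Fintype.card_fin, nsmul_eq_mul]
  push_cast
  rw [add_sub_cancel_right]
  rw [one_div_mul_eq_div]
  congr 1
  field_simp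
  ring

/-- The sample variance of `k + 1` independent standard Gaussian variables is distributed as the
mean of `k` squares of such variables. -/
lemma map_sampleVar_gaussian (k : ℕ) :
    (Measure.pi fun _ : Fin (k + 1) => gaussianReal 0 1).map sampleVar =
      (Measure.pi fun _ : Fin k => gaussianReal 0 1).map fun v => (∑ i, v i ^ 2) / (k : ℝ) := by
  set γ := Measure.pi fun _ : Fin (k + 1) => gaussianReal 0 1 with hγ
  -- The unit vector along the diagonal: k times the sample variance is the squared norm of the
  -- component orthogonal to it.
  set e₀ : EuclideanSpace ℝ (Fin (k + 1)) := WithLp.toLp 2 fun _ => (√((k : ℝ) + 1))⁻¹ with he₀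
  have hk : (0 : ℝ) < (k : ℝ) + 1 := by positivity
  have hsq : √((k : ℝ) + 1) ^ 2 = k + 1 := Real.sq_sqrt hk.le
  have hnorm : ‖e₀‖ = 1 := by
    rw [← sq_eq_sq₀ (norm_nonneg _) zero_le_one, EuclideanSpace.real_norm_sq_eq]
    simp only [he₀, Finset.sum_const, Finset.card_univ, Fintype.card_fin, nsmul_eq_mul, inv_pow, hsq]
    push_cast
    field_simp
  obtain ⟨b, hb⟩ := Orthonormal.exists_orthonormalBasis_extension_of_card_eq (𝕜 := ℝ)
    (E := EuclideanSpace ℝ (Fin (k + 1))) (ι := Fin (k + 1)) (by simp) (v := fun _ => e₀)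
    (s := {0}) (by
      rw [orthonormal_iff_ite]
      rintro ⟨i, hi⟩ ⟨j, hj⟩
      rw [Set.mem_singleton_iff] at hi hj
      subst hi hj
      simp [hnorm])
  have hb0 : b 0 = e₀ := hb 0 rfl
  set S : EuclideanSpace ℝ (Fin (k + 1)) → ℝ := fun z => (‖z‖ ^ 2 - inner ℝ (b 0) z ^ 2) / k with hS
  have mS : Measurable S := by
    have : Continuous S := by rw [hS]; fun_prop
    exact this.measurable
  have mL : Measurable (WithLp.toLp 2 : (Fin (k + 1) → ℝ) → EuclideanSpace ℝ (Fin (k + 1))) :=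
    WithLp.measurable_toLp 2 _
  have mb : Measurable fun x : Fin (k + 1) → ℝ => ∑ i, x i • b i := by
    have : Continuous fun x : Fin (k + 1) → ℝ => ∑ i, x i • b i := by fun_prop
    exact this.measurable
  have h1 : (sampleVar : (Fin (k + 1) → ℝ) → ℝ) = S ∘ WithLp.toLp 2 := by
    ext y
    rw [sampleVar_eq_norm_sq_sub]
    simp only [hS, Function.comp_apply, hb0, EuclideanSpace.real_norm_sq_eq, PiLp.inner_apply, he₀,
      RCLike.inner_apply, conj_trivial, ← Finset.sum_mul]
    rw [mul_pow, inv_pow, hsq, ← div_eq_mul_inv]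
  have h2 : S ∘ (fun x : Fin (k + 1) → ℝ => ∑ i, x i • b i) =
      (fun v : Fin k → ℝ => (∑ i, v i ^ 2) / (k : ℝ)) ∘ fun x => Fin.tail x := by
    ext x
    have hn : ‖∑ i, x i • b i‖ ^ 2 = ∑ i, x i ^ 2 := by
      rw [← real_inner_self_eq_norm_sq, b.orthonormal.inner_sum]
      simp [sq]
    have hi : inner ℝ (b 0) (∑ i, x i • b i) = x 0 := by
      rw [b.orthonormal.inner_right_fintype]
    simp only [hS, Function.comp_apply, hn, hi, Fin.tail]
    rw [Fin.sum_univ_succ]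
    ring
  have htail : MeasurePreserving (fun x : Fin (k + 1) → ℝ => Fin.tail x) γ
      (Measure.pi fun _ : Fin k => gaussianReal 0 1) := by
    have := (measurePreserving_snd (μ := gaussianReal 0 1)
      (ν := Measure.pi fun _ : Fin k => gaussianReal 0 1)).comp
      (measurePreserving_piFinSuccAbove (fun _ : Fin (k + 1) => gaussianReal 0 1) 0)
    exact this
  -- Rotation invariance: the coordinates in the basis b are again independent standard Gaussians,
  -- and S simply drops the one along b 0 = e₀.
  rw [h1, ← Measure.map_map mS mL, map_pi_eq_stdGaussian, stdGaussian_eq_map_pi_orthonormalBasis b,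
    Measure.map_map mS mb, h2, ← Measure.map_map (measurable_sum_sq_div k) htail.measurable,
    htail.map_eq]

lemma measureReal_abs_le_mul_sqrt_sampleVar {k : ℕ} (hk : k ≠ 0) (c : ℝ) :
    ((gaussianReal 0 1).prod (Measure.pi fun _ : Fin (k + 1) => gaussianReal 0 1)).real
      {zy | |zy.1| ≤ c * √(sampleVar zy.2)} = (studentT k).real (Set.Icc (-c) c) := by
  have mV := (continuous_sampleVar (k + 1)).measurable
  have mW := measurable_sum_sq_div k
  have mA : MeasurableSet {zu : ℝ × ℝ | |zu.1| ≤ c * √zu.2} :=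
    measurableSet_le (by fun_prop) (by fun_prop)
  have e1 : ((gaussianReal 0 1).prod (Measure.pi fun _ : Fin (k + 1) => gaussianReal 0 1)).map
        (Prod.map id sampleVar) =
      ((gaussianReal 0 1).prod (Measure.pi fun _ : Fin k => gaussianReal 0 1)).map
        (Prod.map id fun v => (∑ i, v i ^ 2) / (k : ℝ)) := by
    -- Because Z is independent of the sample, only the marginal law of the sample variance matters
    -- for the joint law.
    rw [← Measure.map_prod_map _ _ measurable_id mV, ← Measure.map_prod_map _ _ measurable_id mW,
      map_sampleVar_gaussian]
  have e2 := congrArg (fun m : Measure (ℝ × ℝ) => m.real {zu : ℝ × ℝ | |zu.1| ≤ c * √zu.2}) e1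
  rw [map_measureReal_apply (measurable_id.prodMap mV) mA,
    map_measureReal_apply (measurable_id.prodMap mW) mA] at e2
  refine e2.trans ?_
  rw [studentT, map_measureReal_apply (measurable_studentRatio k) measurableSet_Icc]
  refine measureReal_congr ?_
  have hpos := (Measure.quasiMeasurePreserving_snd (μ := gaussianReal 0 1)
    (ν := Measure.pi fun _ : Fin k => gaussianReal 0 1)).ae (ae_sum_sq_div_pos hk)
  filter_upwards [hpos] with zv hzv
  have hs := Real.sqrt_pos.2 hzv
  refine propext ?_
  change |zv.1| ≤ c * √((∑ i, zv.2 i ^ 2) / k) ↔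
    zv.1 / √((∑ i, zv.2 i ^ 2) / k) ∈ Set.Icc (-c) c
  rw [Set.mem_Icc, ← abs_le, abs_div, abs_of_pos hs, div_le_iff₀ hs]

end

section

/-! ### Coverage -/

/-- The values of the normalized errors for which the interval covers the target. -/
def coverageRegion (B : ℕ) (c : ℝ) : Set (WithLp 2 (ℝ × EuclideanSpace ℝ (Fin B))) :=
  {V | |V.fst| ≤ c * √(sampleVar fun b => V.snd b)}

lemma continuous_coverageBound (B : ℕ) (c : ℝ) :
    Continuous fun V : WithLp 2 (ℝ × EuclideanSpace ℝ (Fin B)) =>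
      c * √(sampleVar fun b => V.snd b) := by
  have h1 : Continuous fun V : WithLp 2 (ℝ × EuclideanSpace ℝ (Fin B)) => fun b => V.snd b := by
    fun_prop
  exact (Real.continuous_sqrt.comp ((continuous_sampleVar B).comp h1)).const_mul c

lemma continuous_abs_fst (B : ℕ) :
    Continuous fun V : WithLp 2 (ℝ × EuclideanSpace ℝ (Fin B)) => |V.fst| := by
  fun_prop

lemma gaussianLimit_apply {B : ℕ} (v₀ v : ℝ≥0)
    {A : Set (WithLp 2 (ℝ × EuclideanSpace ℝ (Fin B)))} (hA : MeasurableSet A) :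
    (gaussianLimit B v₀ v : Measure (WithLp 2 (ℝ × EuclideanSpace ℝ (Fin B)))) A =
      ((gaussianReal 0 v₀).prod (Measure.pi fun _ : Fin B => gaussianReal 0 v))
        {zy | WithLp.toLp 2 (zy.1, WithLp.toLp 2 zy.2) ∈ A} := by
  have m1 : Measurable (WithLp.toLp 2 : (Fin B → ℝ) → EuclideanSpace ℝ (Fin B)) :=
    WithLp.measurable_toLp 2 _
  have m2 : Measurable (WithLp.toLp 2 : ℝ × EuclideanSpace ℝ (Fin B) → _) :=
    WithLp.measurable_toLp 2 _
  have e : (gaussianReal 0 v₀).prod ((Measure.pi fun _ : Fin B => gaussianReal 0 v).map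
      (WithLp.toLp 2)) = ((gaussianReal 0 v₀).prod
        (Measure.pi fun _ : Fin B => gaussianReal 0 v)).map (Prod.map id (WithLp.toLp 2)) := by
    rw [← Measure.map_prod_map _ _ measurable_id m1, Measure.map_id]
  change (((gaussianReal 0 v₀).prod ((Measure.pi fun _ : Fin B => gaussianReal 0 v).map
      (WithLp.toLp 2))).map (WithLp.toLp 2)) A = _
  rw [e, Measure.map_map m2 (measurable_id.prodMap m1),
    Measure.map_apply (m2.comp (measurable_id.prodMap m1)) hA]
  rfl

/-- The boundary lies where equality holds; for fixed resample coordinates this leaves at most two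
values of the first coordinate, whose law is atomless. -/
lemma gaussianLimit_frontier_coverageRegion (B : ℕ) (c : ℝ) {v₀ : ℝ≥0} (hv₀ : v₀ ≠ 0) (v : ℝ≥0) :
    (gaussianLimit B v₀ v : Measure (WithLp 2 (ℝ × EuclideanSpace ℝ (Fin B))))
      (frontier (coverageRegion B c)) = 0 := by
  have := nullSingletonClass_gaussianReal (μ := 0) hv₀
  set D : Set (WithLp 2 (ℝ × EuclideanSpace ℝ (Fin B))) :=
    {V | |V.fst| = c * √(sampleVar fun b => V.snd b)} with hD
  have mD : MeasurableSet D :=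
    (isClosed_eq (continuous_abs_fst B) (continuous_coverageBound B c)).measurableSet
  refine measure_mono_null (frontier_le_subset_eq (continuous_abs_fst B)
    (continuous_coverageBound B c)) ?_
  change (gaussianLimit B v₀ v : Measure (WithLp 2 (ℝ × EuclideanSpace ℝ (Fin B)))) D = 0
  have mD' : MeasurableSet {zy : ℝ × (Fin B → ℝ) |
      (WithLp.toLp 2 (zy.1, WithLp.toLp 2 zy.2) : WithLp 2 (ℝ × EuclideanSpace ℝ (Fin B))) ∈ D} := by
    have hm : Measurable fun zy : ℝ × (Fin B → ℝ) => c * √(sampleVar zy.2) :=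
      ((Real.continuous_sqrt.comp (continuous_sampleVar B)).measurable.comp measurable_snd).const_mul c
    exact measurableSet_eq_fun (by fun_prop : Measurable fun zy : ℝ × (Fin B → ℝ) => |zy.1|) hm
  rw [gaussianLimit_apply v₀ v mD, Measure.prod_apply_symm mD']
  refine (lintegral_congr fun y => ?_).trans lintegral_zero
  refine measure_mono_null (t := {c * √(sampleVar y), -(c * √(sampleVar y))}) (fun z hz => ?_)
    ((Set.toFinite _).measure_zero _)
  have hz' : |z| = c * √(sampleVar y) := hz
  rw [← hz', Set.mem_insert_iff, Set.mem_singleton_iff]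
  exact eq_or_eq_neg_of_abs_eq rfl

lemma map_sqrt_mul_gaussianReal (v : ℝ≥0) :
    MeasurePreserving (fun x : ℝ => √(v : ℝ) * x) (gaussianReal 0 1) (gaussianReal 0 v) := by
  refine ⟨measurable_const_mul _, ?_⟩
  rw [gaussianReal_map_const_mul, mul_zero]
  congr 1
  ext
  simp

/-- Under the Gaussian limit law, the coverage is given by Student's distribution. -/
lemma gaussianLimit_real_coverageRegion {k : ℕ} (hk : k ≠ 0) (c : ℝ) {v₀ : ℝ≥0} (hv₀ : v₀ ≠ 0)
    (v : ℝ≥0) :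
    (gaussianLimit (k + 1) v₀ v : Measure (WithLp 2 (ℝ × EuclideanSpace ℝ (Fin (k + 1))))).real
      (coverageRegion (k + 1) c) =
      (studentT k).real (Set.Icc (-(c * √(v : ℝ) / √(v₀ : ℝ))) (c * √(v : ℝ) / √(v₀ : ℝ))) := by
  have hpos : 0 < √(v₀ : ℝ) := Real.sqrt_pos.2 (by exact_mod_cast pos_iff_ne_zero.2 hv₀)
  have mA : MeasurableSet (coverageRegion (k + 1) c) :=
    (isClosed_le (continuous_abs_fst _) (continuous_coverageBound _ c)).measurableSet
  have mA' : MeasurableSet {zy : ℝ × (Fin (k + 1) → ℝ) | |zy.1| ≤ c * √(sampleVar zy.2)} :=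
    measurableSet_le (by fun_prop) (((Real.continuous_sqrt.comp
      (continuous_sampleVar _)).measurable.comp measurable_snd).const_mul c)
  have hmp := (map_sqrt_mul_gaussianReal v₀).prod
    (measurePreserving_pi (fun _ : Fin (k + 1) => gaussianReal 0 1)
      (fun _ : Fin (k + 1) => gaussianReal 0 v) fun _ => map_sqrt_mul_gaussianReal v)
  rw [measureReal_def, gaussianLimit_apply v₀ v mA, ← measureReal_abs_le_mul_sqrt_sampleVar hk,
    measureReal_def]
  congr 1
  change ((gaussianReal 0 v₀).prod (Measure.pi fun _ : Fin (k + 1) => gaussianReal 0 v))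
    {zy : ℝ × (Fin (k + 1) → ℝ) | |zy.1| ≤ c * √(sampleVar zy.2)} = _
  rw [← hmp.measure_preimage mA'.nullMeasurableSet]
  congr 1
  ext zy
  have hs : sampleVar (fun i => √(v : ℝ) * zy.2 i) = v * sampleVar zy.2 := by
    have := sampleVar_mul_sub (√(v : ℝ)) 0 zy.2
    simpa using this
  change |√(v₀ : ℝ) * zy.1| ≤ c * √(sampleVar fun i => √(v : ℝ) * zy.2 i) ↔
    |zy.1| ≤ c * √(v : ℝ) / √(v₀ : ℝ) * √(sampleVar zy.2)
  rw [hs, Real.sqrt_mul v.coe_nonneg, abs_mul, abs_of_pos hpos, div_mul_eq_mul_div, le_div_iff₀ hpos,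
    mul_comm |zy.1|, mul_assoc c]

variable {𝒳 Ξ : Type*} [MeasurableSpace 𝒳] {P : ProbabilityMeasure 𝒳}
  {ψ : ProbabilityMeasure 𝒳 → ℝ} {h : ProbabilityMeasure 𝒳 → Ξ → ℝ}

lemma mem_meanCenteredInterval_iff {B : ℕ} {n : ℕ+} {R₀ R : ℕ} (ρ α : ℝ)
    (ω : Outcome 𝒳 Ξ B n R₀ R) :
    ψ P ∈ meanCenteredInterval h ρ α ω ↔
      normalizedErrors P ψ h ω ∈ coverageRegion B (criticalValue B ρ α) := by
  have hn : (0 : ℝ) < n := by exact_mod_cast n.pos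
  have hs : 0 < √(n : ℝ) := Real.sqrt_pos.2 hn
  change _ ↔ |√(n : ℝ) * (pointEstimate h ω - ψ P)| ≤ criticalValue B ρ α *
    √(sampleVar fun b => √(n : ℝ) * (resampleEstimate h ω b - ψ (empirical n ω.1)))
  rw [sampleVar_mul_sub, Real.sqrt_mul (sq_nonneg _), Real.sqrt_sq hs.le, abs_mul, abs_of_pos hs,
    mul_left_comm, mul_le_mul_iff_right₀ hs, abs_le]
  change _ ∧ _ ↔ -(_ * √(sampleVariance h ω)) ≤ _ ∧ _ ≤ _ * √(sampleVariance h ω)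
  constructor
  · rintro ⟨h1, h2⟩; constructor <;> linarith
  · rintro ⟨h1, h2⟩; constructor <;> linarith

variable [MeasurableSpace Ξ] {ν : Measure Ξ}

lemma coverage_eq [IsProbabilityMeasure ν] (hc : IsComputation P ψ h ν) (B : ℕ) (ρ α : ℝ) (n : ℕ+)
    (R₀ R : ℕ) :
    coverage P ψ h ν B ρ α n R₀ R =
      (normalizedErrorsLaw hc B n R₀ R : Measure (WithLp 2 (ℝ × EuclideanSpace ℝ (Fin B)))).real
        (coverageRegion B (criticalValue B ρ α)) := by
  have mA : MeasurableSet (coverageRegion B (criticalValue B ρ α)) :=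
    (isClosed_le (continuous_abs_fst _) (continuous_coverageBound _ _)).measurableSet
  change _ = ((nestedLaw P ν B n R₀ R).map (normalizedErrors P ψ h)).real _
  rw [map_measureReal_apply hc.measurable_normalizedErrors mA, coverage]
  congr 1
  ext ω
  exact mem_meanCenteredInterval_iff ρ α ω

lemma tendsto_coverage [IsProbabilityMeasure ν] (hc : IsComputation P ψ h ν) {σ : ℝ≥0} (hσ : 0 < σ)
    (hb : BootstrapValid P ψ σ) (hmom : MomentConsistent P ψ h ν) {R₀ R : ℕ+ → ℕ} {p₀ p : ℝ}
    (hp₀ : 0 < p₀) (hp : 0 < p)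
    (hR₀ : Tendsto (fun n : ℕ+ => (R₀ n : ℝ) / (n : ℝ)) atTop (𝓝 p₀))
    (hR : Tendsto (fun n : ℕ+ => (R n : ℝ) / (n : ℝ)) atTop (𝓝 p)) {w₀ w : ℝ≥0}
    (hw₀ : (w₀ : ℝ) = (runVariance h ν P).toReal / p₀)
    (hw : (w : ℝ) = (runVariance h ν P).toReal / p) {k : ℕ} (hk : k ≠ 0) (ρ α : ℝ) :
    Tendsto (fun n : ℕ+ => coverage P ψ h ν (k + 1) ρ α n (R₀ n) (R n)) atTop
      (𝓝 ((studentT k).real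
        (Set.Icc (-(criticalValue (k + 1) ρ α * √((σ ^ 2 + w : ℝ≥0) : ℝ) / √((σ ^ 2 + w₀ : ℝ≥0) : ℝ)))
          (criticalValue (k + 1) ρ α * √((σ ^ 2 + w : ℝ≥0) : ℝ) / √((σ ^ 2 + w₀ : ℝ≥0) : ℝ))))) := by
  have hv₀ : σ ^ 2 + w₀ ≠ 0 := by positivity
  have ht := ProbabilityMeasure.tendsto_measure_of_null_frontier_of_tendsto'
    (tendsto_normalizedErrorsLaw hc hb hmom hp₀ hp hR₀ hR hw₀ hw (k + 1))
    (gaussianLimit_frontier_coverageRegion (k + 1) (criticalValue (k + 1) ρ α) hv₀ (σ ^ 2 + w))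
  simp_rw [coverage_eq hc]
  rw [← gaussianLimit_real_coverageRegion hk _ hv₀]
  exact (ENNReal.tendsto_toReal (measure_ne_top _ _)).comp ht

/-- If p ≤ p₀ the resample variance is already the larger. If p₀ ≤ p, multiplying it by ρ⁻² = p/p₀
turns v/p into v/p₀ and can only enlarge s. -/
lemma sqrt_add_div_le_max_mul_sqrt_add_div {s v p₀ p : ℝ} (hs : 0 ≤ s) (hv : 0 ≤ v) (hp₀ : 0 < p₀)
    (hp : 0 < p) : √(s + v / p₀) ≤ max (√(p₀ / p))⁻¹ 1 * √(s + v / p) := by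
  have h1 : 0 ≤ s + v / p := by positivity
  rcases le_total p p₀ with hle | hle
  · refine (Real.sqrt_le_sqrt ?_).trans (le_mul_of_one_le_left (Real.sqrt_nonneg _)
      (le_max_right _ _))
    gcongr
  · refine le_trans ?_ (mul_le_mul_of_nonneg_right (le_max_left _ _) (Real.sqrt_nonneg _))
    rw [← Real.sqrt_inv, inv_div, ← Real.sqrt_mul (by positivity)]
    refine Real.sqrt_le_sqrt ?_
    have h2 : p / p₀ * (s + v / p) = p / p₀ * s + v / p₀ := by field_simp
    rw [h2]
    have h3 : 1 ≤ p / p₀ := (one_le_div hp₀).2 hle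
    nlinarith

end

end CheapBootstrap

end

open CheapBootstrap in
theorem theorem5 {𝒳 Ξ : Type*} [MeasurableSpace 𝒳] [MeasurableSpace Ξ]
    (P : ProbabilityMeasure 𝒳) (ψ : ProbabilityMeasure 𝒳 → ℝ)
    (h : ProbabilityMeasure 𝒳 → Ξ → ℝ) (ν : Measure Ξ) [IsProbabilityMeasure ν]
    (hcomp : IsComputation P ψ h ν)
    (σ : ℝ≥0) (hσ : 0 < σ) (hboot : BootstrapValid P ψ σ)
    (hmom : MomentConsistent P ψ h ν)
    (R₀ R : ℕ+ → ℕ) (p₀ p : ℝ) (hp₀ : 0 < p₀) (hp₀' : p₀ < 1) (hp : 0 < p) (hp' : p < 1)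
    (hR₀ : Tendsto (fun n : ℕ+ => (R₀ n : ℝ) / (n : ℝ)) atTop (𝓝 p₀))
    (hR : Tendsto (fun n : ℕ+ => (R n : ℝ) / (n : ℝ)) atTop (𝓝 p))
    (B : ℕ) (hB : 2 ≤ B) (α : ℝ) (hα₀ : 0 < α) (hα₁ : α < 1)
    (ρ : ℝ) (hρ : ρ = √(p₀ / p)) :
    1 - α ≤ liminf (fun n : ℕ+ => coverage P ψ h ν B ρ α n (R₀ n) (R n)) atTop ∧
    (ρ = 1 →
      Tendsto (fun n : ℕ+ => coverage P ψ h ν B ρ α n (R₀ n) (R n)) atTop (𝓝 (1 - α))) := by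
  -- Here k is the number of degrees of freedom, nonzero because B ≥ 2.
  obtain ⟨k, rfl⟩ : ∃ k, B = k + 1 := ⟨B - 1, by omega⟩
  have hk : k ≠ 0 := by omega
  obtain ⟨hq, hlevel⟩ := measureReal_Icc_quantile_studentT hk hα₀ hα₁
  set v := (runVariance h ν P).toReal with hv
  have hv0 : 0 ≤ v := ENNReal.toReal_nonneg
  have hw₀ : (Real.toNNReal (v / p₀) : ℝ) = v / p₀ := Real.coe_toNNReal _ (by positivity)
  have hw : (Real.toNNReal (v / p) : ℝ) = v / p := Real.coe_toNNReal _ (by positivity)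
  have ht := tendsto_coverage hcomp hσ hboot hmom hp₀ hp hR₀ hR hw₀ hw hk ρ α
  have hpos : 0 < √((σ : ℝ) ^ 2 + v / p₀) := Real.sqrt_pos.2 (by positivity)
  simp only [NNReal.coe_add, NNReal.coe_pow, hw₀, hw, criticalValue, Nat.add_sub_cancel] at ht
  set t := quantile (studentT k) (1 - α / 2)
  constructor
  -- Coverage has a limit for every ρ; enlarging the Student interval beyond its quantile t shows
  -- that this limit is at least 1 - α.
  · have hle : t ≤ max ρ⁻¹ 1 * t * √((σ : ℝ) ^ 2 + v / p) / √((σ : ℝ) ^ 2 + v / p₀) := by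
      rw [le_div_iff₀ hpos, mul_right_comm, mul_comm]
      rw [hρ]
      exact mul_le_mul_of_nonneg_right
        (sqrt_add_div_le_max_mul_sqrt_add_div (sq_nonneg _) hv0 hp₀ hp) hq
    rw [ht.liminf_eq, ← hlevel]
    exact measureReal_mono (Set.Icc_subset_Icc (neg_le_neg hle) hle)
  · rintro rfl
    -- Equal limiting ratios make the two limit variances equal, so the threshold is exactly t.
    have hpp : p₀ = p := by
      have h1 : p₀ / p = 1 := by
        rw [← Real.sq_sqrt (div_nonneg hp₀.le hp.le), ← hρ, one_pow]
      rwa [div_eq_one_iff_eq hp.ne'] at h1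
    subst hpp
    rwa [inv_one, max_self, one_mul, mul_div_cancel_right₀ _ hpos.ne', hlevel] at ht
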